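/- **Theorem 4.1** (Keating–Snaith central limit theorem). For $N\ge 1$ let $V_N$ be a random matrix distributed according to the normalised Haar measure on the unitary group $U(N)$, and let $e^{i\theta_1},\dots,e^{i\theta_N}$ be its eigenvalues, counted with multiplicity. Let $Z_N:=\det(I_N-V_N)$ and define its logarithm by $$\log Z_N:=\sum_{n=1}^N\log\bigl(1-e^{i\theta_n}\bigr),\qquad \operatorname{Im}\log\bigl(1-e^{i\theta_n}\bigr)\in\left(-\tfrac{\pi}{2},\tfrac{\pi}{2}\right]$$ (this is defined almost surely, namely whenever $1$ is not an eigenvalue of $V_N$). Then $$\frac{\log Z_N}{\sqrt{\tfrac12\log N}}\ \longrightarrow\ \mathcal N_1+i\,\mathcal N_2\qquad\text{in law, as } N\to\infty,$$ where $\mathcal N_1$ and $\mathcal N_2$ are independent standard (mean $0$, variance $1$) real Gaussian random variables. -/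

import Mathlib

open MeasureTheory ProbabilityTheory Filter

/-- The Borel σ-algebra on the unitary group `U(n)`. -/
noncomputable instance unitaryGroupMeasurableSpace (n : ℕ) :
    MeasurableSpace (Matrix.unitaryGroup (Fin n) ℂ) := borel _

instance unitaryGroupBorelSpace (n : ℕ) :
    BorelSpace (Matrix.unitaryGroup (Fin n) ℂ) := ⟨rfl⟩

/-- The unitary group `U(n)`, with the topology induced by the entries, is compact. -/
instance unitaryGroupCompactSpace (n : ℕ) :
    CompactSpace (Matrix.unitaryGroup (Fin n) ℂ) := by
  apply isCompact_iff_compactSpace.mp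
  have hbox : IsCompact (Set.pi Set.univ fun _ : Fin n => Set.pi Set.univ fun _ : Fin n =>
      Metric.closedBall (0 : ℂ) 1) :=
    isCompact_univ_pi fun _ => isCompact_univ_pi fun _ => isCompact_closedBall _ _
  have hclosed : IsClosed (Matrix.unitaryGroup (Fin n) ℂ : Set (Matrix (Fin n) (Fin n) ℂ)) :=
    isClosed_unitary
  refine IsCompact.of_isClosed_subset hbox hclosed fun U hU => ?_
  intro i _ j _
  simpa using entry_norm_bound_of_unitary hU i j

/-- The Haar measure `μ_{U(n)}` on the unitary group, normalised to total mass one. -/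
noncomputable def unitaryHaar (n : ℕ) : Measure (Matrix.unitaryGroup (Fin n) ℂ) :=
  Measure.haarMeasure ⊤

instance unitaryHaarIsHaarMeasure (n : ℕ) : (unitaryHaar n).IsHaarMeasure :=
  inferInstanceAs (Measure.haarMeasure ⊤).IsHaarMeasure

instance unitaryHaarIsProbabilityMeasure (n : ℕ) : IsProbabilityMeasure (unitaryHaar n) :=
  ⟨Measure.haarMeasure_self (K₀ := ⊤)⟩

/-- The logarithm `log det (1 - V)` of the characteristic polynomial at `1`, that is
`∑ log (1 - λ)` over the eigenvalues `λ` of `V`, counted with their algebraic multiplicity.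
For unitary `V` every `1 - λ` lies in the right half-plane or is zero, so the principal logarithm
`Complex.log (1 - λ)` is the branch with imaginary part in `(-π/2, π/2]`. When `1` is an eigenvalue
(a Haar-null event) that eigenvalue contributes `Complex.log 0 = 0`. -/
noncomputable def logDetOneSub {n : ℕ} (V : Matrix (Fin n) (Fin n) ℂ) : ℂ :=
  (V.charpoly.roots.map fun z => Complex.log (1 - z)).sum

/-! `log Z_N` is in law a sum of independent small terms, and the limit follows by multiplying
characteristic functions.

Eliminating the upper left entry `a` of `1 - V` gives `det (1 - V) = (1 - a) det (1 - W)` with `W`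
again unitary (`schurCorner_mem_unitaryGroup`). The identity lifts to the chosen branches of the
logarithm (`logDetOneSub_eq_log_add`). The map `V ↦ W` is equivariant under `U(n)`, so for Haar
distributed `V` the matrix `W` is Haar distributed and independent of `a` (`integral_mul_schurMap`).
Iterating, `log Z_N` has the law of `∑ log (1 - a_k)`, `k = 1, …, N`, with `a_k` independent and
distributed as an entry of a Haar matrix in `U(k)`.

Write `log (1 - a_k) = -a_k + R_k`. Invariance under scalar matrices makes distinct powers of `a_k`
orthogonal, so both parts are centred. Householder reflections give `E|a_k|² = 1/k` and `E|a_k|⁴ =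
2/(k(k+1))`, whence `E|R_k|² = O(k⁻²)`. So the characteristic function of the `k`-th term at `ξ` is
`1 - |ξ|²/(4k)`, up to `O((|ξ|² + |ξ|⁴) k^(-3/2))` (`norm_integral_exp_inner_log_sub_le`).

These errors are summable in `k`. The product is therefore `exp (-|ξ|² H_N / 4) + O(|ξ|² + |ξ|⁴)`,
with `H_N` the harmonic number and a bound uniform in `N`. At `ξ = t / √(½ log N)` the error
vanishes and the main term tends to `exp (-|t|²/2)`; Lévy's continuity theorem concludes. -/

/-! ### Schur complements and unitarity of Neretin's map. -/

open scoped Matrix in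
theorem Matrix.det_eq_mul_det_schur {n : ℕ} {K : Type*} [Field K]
    (M : Matrix (Fin (n + 1)) (Fin (n + 1)) K) (h : M 0 0 ≠ 0) :
    M.det = M 0 0 *
      (Matrix.of fun i j : Fin n => M i.succ j.succ - M i.succ 0 * M 0 j.succ / M 0 0).det := by
  let B : Matrix (Fin (n + 1)) (Fin (n + 1)) K :=
    Matrix.of fun i j => Fin.cases (M 0 j) (fun i' => M i'.succ j - M i'.succ 0 / M 0 0 * M 0 j) i
  have hB : M.det = B.det := by
    refine Matrix.det_eq_of_forall_row_eq_smul_add_const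
      (Fin.cons 0 fun i => M i.succ 0 / M 0 0) 0 (by simp) ?_
    intro i j
    refine Fin.cases ?_ (fun i' => ?_) i <;> simp [B]
  rw [hB, Matrix.det_succ_column_zero, Fin.sum_univ_succ]
  have h0 : ∀ i : Fin n, B i.succ 0 = 0 := fun i => by simp [B, h]
  simp only [h0]
  simp only [Fin.val_zero, pow_zero, one_mul, mul_zero, zero_mul, Finset.sum_const_zero, add_zero]
  congr 2
  ext i j
  simp [B]
  ring

/-- Neretin's map: the Schur complement of `1 - V` in its upper left entry is
`1 - schurCorner V`. -/
noncomputable def schurCorner {n : ℕ} (V : Matrix (Fin (n + 1)) (Fin (n + 1)) ℂ) :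
    Matrix (Fin n) (Fin n) ℂ :=
  Matrix.of fun i j => V i.succ j.succ + V i.succ 0 * V 0 j.succ / (1 - V 0 0)

/-- Row `0` is left without the factor `r`: then `r` occurs exactly once in each correction term of
the Schur complement, which becomes `1 - r • schurCorner V`. -/
theorem det_updateRow_one_sub_smul {n : ℕ} (V : Matrix (Fin (n + 1)) (Fin (n + 1)) ℂ)
    (h : V 0 0 ≠ 1) (r : ℂ) :
    ((1 - r • V).updateRow 0 ((1 - V) 0)).det = (1 - V 0 0) * (1 - r • schurCorner V).det := by
  have h' : 1 - V 0 0 ≠ 0 := sub_ne_zero.2 h.symm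
  have h00 : (1 - r • V).updateRow 0 ((1 - V) 0) 0 0 = 1 - V 0 0 := by simp
  rw [Matrix.det_eq_mul_det_schur _ (by rwa [h00]), h00]
  congr 2
  ext i j
  have : (0 : Fin (n + 1)) ≠ j.succ := (Fin.succ_ne_zero j).symm
  simp [schurCorner, Matrix.one_apply, Matrix.updateRow_apply, this]
  ring

theorem det_one_sub_eq {n : ℕ} (V : Matrix (Fin (n + 1)) (Fin (n + 1)) ℂ) (h : V 0 0 ≠ 1) :
    (1 - V).det = (1 - V 0 0) * (1 - schurCorner V).det := by
  have := det_updateRow_one_sub_smul V h 1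
  simpa using this

open scoped Matrix in
theorem schurCorner_mem_unitaryGroup {n : ℕ} {V : Matrix (Fin (n + 1)) (Fin (n + 1)) ℂ}
    (hV : V ∈ Matrix.unitaryGroup (Fin (n + 1)) ℂ) (h : V 0 0 ≠ 1) :
    schurCorner V ∈ Matrix.unitaryGroup (Fin n) ℂ := by
  have h' : 1 - V 0 0 ≠ 0 := sub_ne_zero.2 h.symm
  -- Column `j` is `(x, e_j)`, where `x` solves `x = V 0 0 * x + V 0 j.succ`. Thus `V` preserves its
  -- coordinate `0` and sends the rest to column `j` of `schurCorner V`. As `V` preserves inner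
  -- products, cancelling coordinate `0` leaves those of the `e_j`.
  let E : Matrix (Fin (n + 1)) (Fin n) ℂ :=
    Matrix.of (Fin.cons (fun j => V 0 j.succ / (1 - V 0 0)) fun i j => if i = j then 1 else 0)
  have hVE0 : ∀ j, (V * E) 0 j = E 0 j := fun j => by
    simp [E, Matrix.mul_apply, Fin.sum_univ_succ]
    field_simp
    ring
  have hVE : ∀ i j, (V * E) (Fin.succ i) j = schurCorner V i j := fun i j => by
    simp [E, Matrix.mul_apply, Fin.sum_univ_succ, schurCorner]
    ring
  have key : (V * E)ᴴ * (V * E) = Eᴴ * E := by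
    have := Matrix.mem_unitaryGroup_iff'.1 hV
    rw [Matrix.star_eq_conjTranspose] at this
    rw [Matrix.conjTranspose_mul, Matrix.mul_assoc, ← Matrix.mul_assoc Vᴴ, this, Matrix.one_mul]
  rw [Matrix.mem_unitaryGroup_iff']
  ext i j
  have := congrFun (congrFun key i) j
  rw [Matrix.mul_apply, Matrix.mul_apply, Fin.sum_univ_succ, Fin.sum_univ_succ] at this
  simp only [Matrix.conjTranspose_apply, hVE0, hVE] at this
  have := add_left_cancel this
  rw [Matrix.mul_apply, Matrix.one_apply]
  simp only [Matrix.star_apply, this]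
  simp [E, eq_comm]

/-! ### Eigenvalues, and splitting the logarithm with the correct branch. -/

open scoped Matrix ComplexOrder in
theorem norm_eq_one_of_mem_roots_charpoly {n : ℕ} {V : Matrix (Fin n) (Fin n) ℂ}
    (hV : V ∈ Matrix.unitaryGroup (Fin n) ℂ) {z : ℂ} (hz : z ∈ V.charpoly.roots) : ‖z‖ = 1 := by
  have h0 := (Polynomial.mem_roots'.1 hz).2
  rw [Polynomial.IsRoot.def, Matrix.eval_charpoly] at h0
  obtain ⟨v, hv, hv0⟩ := Matrix.exists_mulVec_eq_zero_iff.2 h0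
  have hVv : V *ᵥ v = z • v := by
    rw [Matrix.sub_mulVec, sub_eq_zero] at hv0
    rw [← hv0]
    ext i
    simp [Matrix.scalar_apply, Matrix.mulVec_diagonal]
  have h1 : star (V *ᵥ v) ⬝ᵥ (V *ᵥ v) = star v ⬝ᵥ v := by
    have := Matrix.mem_unitaryGroup_iff'.1 hV
    rw [Matrix.star_eq_conjTranspose] at this
    rw [Matrix.star_mulVec, Matrix.dotProduct_mulVec, Matrix.vecMul_vecMul, this, Matrix.vecMul_one]
  have h2 : star v ⬝ᵥ v ≠ 0 := fun h =>
    hv (dotProduct_star_self_eq_zero.1 h)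
  rw [hVv, star_smul, smul_dotProduct, dotProduct_smul, smul_smul, smul_eq_mul] at h1
  have h3 : star z * z = 1 := mul_right_cancel₀ h2 (by rw [h1, one_mul])
  have h4 : ‖z‖ ^ 2 = 1 := by
    have := congrArg norm h3
    rw [norm_mul, norm_star, norm_one] at this
    rw [sq, this]
  exact (pow_eq_one_iff_of_nonneg (norm_nonneg z) two_ne_zero).1 h4

theorem det_one_sub_smul_eq_prod {n : ℕ} (V : Matrix (Fin n) (Fin n) ℂ) (r : ℂ) :
    (1 - r • V).det = (V.charpoly.roots.map fun z => 1 - r * z).prod := by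
  have hsplit : V.charpoly = (V.charpoly.roots.map fun z => Polynomial.X - Polynomial.C z).prod :=
    ((IsAlgClosed.splits V.charpoly).eq_prod_roots_of_monic V.charpoly_monic)
  have hcard : V.charpoly.roots.card = n := by
    rw [← (IsAlgClosed.splits V.charpoly).natDegree_eq_card_roots, Matrix.charpoly_natDegree_eq_dim,
      Fintype.card_fin]
  by_cases hr : r = 0
  · simp [hr]
  have h1 : (1 - r • V) = r • (Matrix.scalar (Fin n) r⁻¹ - V) := by
    rw [smul_sub]
    congr 1
    ext i j
    simp [Matrix.scalar_apply, Matrix.diagonal_apply, Matrix.one_apply, hr]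
  have h2 : (V.charpoly.eval r⁻¹) = (V.charpoly.roots.map fun z => r⁻¹ - z).prod := by
    conv_lhs => rw [hsplit]
    rw [Polynomial.eval_multiset_prod, Multiset.map_map]
    simp
  have h3 : ∀ s : Multiset ℂ,
      (s.map fun z => 1 - r * z).prod = r ^ s.card * (s.map fun z => r⁻¹ - z).prod := fun s => by
    induction s using Multiset.induction_on with
    | empty => simp
    | cons z s ih =>
      simp only [Multiset.map_cons, Multiset.prod_cons, Multiset.card_cons, ih, pow_succ]
      field_simp
  rw [h1, Matrix.det_smul, ← Matrix.eval_charpoly, h2, Fintype.card_fin, h3, hcard]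

theorem re_lt_one_of_norm_eq_one {z : ℂ} (hz : ‖z‖ = 1) (h1 : z ≠ 1) : z.re < 1 := by
  by_contra! h
  have h2 := Complex.sq_norm z
  rw [hz, Complex.normSq_apply] at h2
  have h3 : z.im = 0 := by nlinarith [mul_self_nonneg z.im]
  have h4 : z.re = 1 := by nlinarith
  exact h1 (Complex.ext h4 h3)

theorem re_one_sub_mul_pos {z : ℂ} (hz : ‖z‖ = 1) (h1 : z ≠ 1) {r : ℝ} (hr : r ∈ Set.Icc (0 : ℝ) 1) :
    0 < (1 - (r : ℂ) * z).re := by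
  have := re_lt_one_of_norm_eq_one hz h1
  simp only [Complex.sub_re, Complex.one_re, Complex.re_ofReal_mul]
  rcases le_total z.re 0 with h | h <;> nlinarith [hr.1, hr.2]

theorem mem_roots_charpoly_ne_one {n : ℕ} {V : Matrix (Fin n) (Fin n) ℂ}
    (h : (1 - V).det ≠ 0) {z : ℂ} (hz : z ∈ V.charpoly.roots) : z ≠ 1 := by
  rintro rfl
  apply h
  have := (Polynomial.mem_roots'.1 hz).2
  rw [Polynomial.IsRoot.def, Matrix.eval_charpoly] at this
  simpa using this

theorem det_one_sub_smul_ne_zero {n : ℕ} {V : Matrix (Fin n) (Fin n) ℂ}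
    (hV : V ∈ Matrix.unitaryGroup (Fin n) ℂ) (h : (1 - V).det ≠ 0) {r : ℝ}
    (hr : r ∈ Set.Icc (0 : ℝ) 1) : (1 - (r : ℂ) • V).det ≠ 0 := by
  rw [det_one_sub_smul_eq_prod]
  refine Multiset.prod_ne_zero fun h0 => ?_
  obtain ⟨z, hz, hz0⟩ := Multiset.mem_map.1 h0
  have := re_one_sub_mul_pos (norm_eq_one_of_mem_roots_charpoly hV hz)
    (mem_roots_charpoly_ne_one h hz) hr
  rw [hz0] at this
  simp at this

-- Since `‖V y‖ = ‖y‖`, both sides equal `2 (1 + r) (‖y‖² - Re ⟨y, V y⟩)`.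
open scoped Matrix in
theorem re_dotProduct_one_sub_smul_mulVec {n : ℕ} {V : Matrix (Fin n) (Fin n) ℂ}
    (hV : V ∈ Matrix.unitaryGroup (Fin n) ℂ) (r : ℝ) (y : Fin n → ℂ) :
    2 * (star ((1 - (r : ℂ) • V) *ᵥ y) ⬝ᵥ ((1 - V) *ᵥ y)).re =
      (1 + r) * (star ((1 - V) *ᵥ y) ⬝ᵥ ((1 - V) *ᵥ y)).re := by
  have h1 : star (V *ᵥ y) ⬝ᵥ (V *ᵥ y) = star y ⬝ᵥ y := by
    have := Matrix.mem_unitaryGroup_iff'.1 hV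
    rw [Matrix.star_eq_conjTranspose] at this
    rw [Matrix.star_mulVec, Matrix.dotProduct_mulVec, Matrix.vecMul_vecMul, this, Matrix.vecMul_one]
  have h2 : (star (V *ᵥ y) ⬝ᵥ y).re = (star y ⬝ᵥ (V *ᵥ y)).re := by
    rw [← Complex.conj_re, ← Complex.star_def, Matrix.star_dotProduct, star_star]
  simp only [Matrix.sub_mulVec, Matrix.one_mulVec, Matrix.smul_mulVec, star_sub, star_smul,
    sub_dotProduct, dotProduct_sub, smul_dotProduct, smul_eq_mul, Complex.star_def,
    Complex.conj_ofReal, h1, Complex.sub_re, Complex.re_ofReal_mul, h2]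
  ring

open scoped Matrix in
theorem det_updateRow_div_det {n : Type*} [Fintype n] [DecidableEq n] {K : Type*} [Field K]
    (M : Matrix n n K) (i : n) (x : n → K) :
    (M.updateRow i x).det / M.det = x ⬝ᵥ (M⁻¹ *ᵥ Pi.single i 1) := by
  rw [← Matrix.cramer_transpose_apply, Matrix.cramer_eq_adjugate_mulVec, ← Matrix.adjugate_transpose,
    Matrix.mulVec_transpose, Matrix.inv_def, Ring.inverse_eq_inv', Matrix.mulVec_single_one,
    div_eq_inv_mul]
  change _ = x ⬝ᵥ (M.det⁻¹ • M.adjugate.col i)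
  rw [dotProduct_smul, smul_eq_mul]
  rfl

-- The ratio compares two determinants that differ only in row `0`. By Cramer's rule it is entry `0`
-- of `(1 - V) y`, where `(1 - r V) y = e_0`; hence it is `⟨(1 - r V) y, (1 - V) y⟩`, whose real
-- part is a positive multiple of `‖(1 - V) y‖²`.
open scoped Matrix ComplexOrder in
theorem re_schur_ratio_pos {n : ℕ} {V : Matrix (Fin (n + 1)) (Fin (n + 1)) ℂ}
    (hV : V ∈ Matrix.unitaryGroup (Fin (n + 1)) ℂ) (h : V 0 0 ≠ 1) (h1 : (1 - V).det ≠ 0) {r : ℝ}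
    (hr : r ∈ Set.Icc (0 : ℝ) 1) :
    0 < ((1 - V 0 0) * (1 - (r : ℂ) • schurCorner V).det / (1 - (r : ℂ) • V).det).re := by
  have hM := det_one_sub_smul_ne_zero hV h1 hr
  obtain ⟨y, hy0⟩ : ∃ y, y = (1 - (r : ℂ) • V)⁻¹ *ᵥ Pi.single 0 1 := ⟨_, rfl⟩
  have hy : (1 - (r : ℂ) • V) *ᵥ y = Pi.single 0 1 := by
    rw [hy0, Matrix.mulVec_mulVec, Matrix.mul_nonsing_inv _ (isUnit_iff_ne_zero.2 hM),
      Matrix.one_mulVec]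
  have hq : (1 - V 0 0) * (1 - (r : ℂ) • schurCorner V).det / (1 - (r : ℂ) • V).det =
      star ((1 - (r : ℂ) • V) *ᵥ y) ⬝ᵥ ((1 - V) *ᵥ y) := by
    rw [← det_updateRow_one_sub_smul V h, hy, det_updateRow_div_det, ← hy0]
    have : star (Pi.single 0 1 : Fin (n + 1) → ℂ) = Pi.single 0 1 := by
      ext i
      refine Fin.cases ?_ (fun i => ?_) i <;> simp
    rw [this, single_one_dotProduct]
    rfl
  rw [hq]
  have key := re_dotProduct_one_sub_smul_mulVec hV r y
  have hne : (1 - V) *ᵥ y ≠ 0 := fun h0 => by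
    have hy0 : y ≠ 0 := fun h => by
      rw [h, Matrix.mulVec_zero] at hy
      simpa using congrFun hy 0
    exact h1 (Matrix.exists_mulVec_eq_zero_iff.1 ⟨y, hy0, h0⟩)
  have hpos : 0 < (star ((1 - V) *ᵥ y) ⬝ᵥ ((1 - V) *ᵥ y)).re :=
    (Complex.pos_iff.1 (Matrix.dotProduct_star_self_pos_iff.2 hne)).1
  nlinarith [hr.1]

theorem continuousOn_sum_log {s : Multiset ℂ} (hs : ∀ z ∈ s, ‖z‖ = 1 ∧ z ≠ 1) :
    ContinuousOn (fun r : ℝ => (s.map fun z => Complex.log (1 - (r : ℂ) * z)).sum)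
      (Set.Icc 0 1) := by
  induction s using Multiset.induction_on with
  | empty => simpa using continuousOn_const
  | cons z s ih =>
    simp only [Multiset.map_cons, Multiset.sum_cons]
    refine ContinuousOn.add ?_ (ih fun w hw => hs w (Multiset.mem_cons_of_mem hw))
    refine ContinuousOn.clog (by fun_prop) fun r hr => Or.inl ?_
    have := hs z (Multiset.mem_cons_self z s)
    exact re_one_sub_mul_pos this.1 this.2 hr

theorem exp_sum_log {s : Multiset ℂ} (hs : ∀ z ∈ s, ‖z‖ = 1 ∧ z ≠ 1) {r : ℝ}
    (hr : r ∈ Set.Icc (0 : ℝ) 1) :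
    Complex.exp (s.map fun z => Complex.log (1 - (r : ℂ) * z)).sum =
      (s.map fun z => 1 - (r : ℂ) * z).prod := by
  induction s using Multiset.induction_on with
  | empty => simp
  | cons z s ih =>
    have h := hs z (Multiset.mem_cons_self z s)
    have h0 : 1 - (r : ℂ) * z ≠ 0 := fun h0 => by
      have := re_one_sub_mul_pos h.1 h.2 hr
      simp [h0] at this
    simp only [Multiset.map_cons, Multiset.sum_cons, Multiset.prod_cons, Complex.exp_add,
      Complex.exp_log h0, ih fun w hw => hs w (Multiset.mem_cons_of_mem hw)]

theorem ContinuousOn.eq_of_exp_eq_one {F : ℝ → ℂ} (hF : ContinuousOn F (Set.Icc 0 1))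
    (h : ∀ r ∈ Set.Icc (0 : ℝ) 1, Complex.exp (F r) = 1) : F 1 = F 0 := by
  have hT : ∀ r ∈ Set.Icc (0 : ℝ) 1, ∃ k : ℤ, (F r / (2 * Real.pi * Complex.I)) = k := fun r hr => by
    obtain ⟨k, hk⟩ := Complex.exp_eq_one_iff.1 (h r hr)
    exact ⟨k, by rw [hk]; field_simp⟩
  have hd : DiscreteTopology (Set.range ((↑) : ℤ → ℝ)) :=
    (Int.isClosedEmbedding_coe_real.isEmbedding.toHomeomorph).symm.isEmbedding.discreteTopology
  have hc : ContinuousOn (fun r => (F r / (2 * Real.pi * Complex.I)).re) (Set.Icc 0 1) :=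
    Complex.continuous_re.comp_continuousOn (hF.div_const _)
  have := isPreconnected_Icc.constant_of_mapsTo (T := Set.range ((↑) : ℤ → ℝ)) ⟨hd⟩ hc
    (fun r hr => by obtain ⟨k, hk⟩ := hT r hr; exact ⟨k, by simp [hk]⟩)
    (Set.right_mem_Icc.2 zero_le_one) (Set.left_mem_Icc.2 zero_le_one)
  obtain ⟨k, hk⟩ := hT 1 (Set.right_mem_Icc.2 zero_le_one)
  obtain ⟨l, hl⟩ := hT 0 (Set.left_mem_Icc.2 zero_le_one)
  simp only [hk, hl, Complex.intCast_re, Int.cast_inj] at this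
  rw [div_eq_iff (by simp [Real.pi_ne_zero])] at hk hl
  rw [hk, hl, this]

/-- Both sides have the same exponential, so they differ by a multiple of `2πi`. Replacing the
matrices by `r V` and `r • schurCorner V` and moving `r` from `0` to `1` shows that the multiple is
zero. -/
theorem logDetOneSub_eq_log_add {n : ℕ} {V : Matrix (Fin (n + 1)) (Fin (n + 1)) ℂ}
    (hV : V ∈ Matrix.unitaryGroup (Fin (n + 1)) ℂ) (h : V 0 0 ≠ 1)
    (h1 : (1 - schurCorner V).det ≠ 0) :
    logDetOneSub V = Complex.log (1 - V 0 0) + logDetOneSub (schurCorner V) := by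
  have ha : 1 - V 0 0 ≠ 0 := sub_ne_zero.2 h.symm
  have hV1 : (1 - V).det ≠ 0 := by
    rw [det_one_sub_eq V h]
    exact mul_ne_zero ha h1
  have hW := schurCorner_mem_unitaryGroup hV h
  have hsV : ∀ z ∈ V.charpoly.roots, ‖z‖ = 1 ∧ z ≠ 1 := fun z hz =>
    ⟨norm_eq_one_of_mem_roots_charpoly hV hz, mem_roots_charpoly_ne_one hV1 hz⟩
  have hsW : ∀ z ∈ (schurCorner V).charpoly.roots, ‖z‖ = 1 ∧ z ≠ 1 := fun z hz =>
    ⟨norm_eq_one_of_mem_roots_charpoly hW hz, mem_roots_charpoly_ne_one h1 hz⟩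
  let q : ℝ → ℂ := fun r =>
    (1 - V 0 0) * (1 - (r : ℂ) • schurCorner V).det / (1 - (r : ℂ) • V).det
  have hq : ∀ r ∈ Set.Icc (0 : ℝ) 1, 0 < (q r).re := fun r hr => re_schur_ratio_pos hV h hV1 hr
  -- The term `log (q r)` makes `exp (F r) = 1` for every `r`, and it is continuous because `q r`
  -- stays in the right half-plane. At `r = 0` everything cancels; at `r = 1` one has `q 1 = 1`, and
  -- `F 1` is the difference to be killed.
  let F : ℝ → ℂ := fun r =>
    (V.charpoly.roots.map fun z => Complex.log (1 - (r : ℂ) * z)).sum -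
      ((schurCorner V).charpoly.roots.map fun z => Complex.log (1 - (r : ℂ) * z)).sum +
      Complex.log (q r) - Complex.log (1 - V 0 0)
  have hF : ContinuousOn F (Set.Icc 0 1) := by
    refine (((continuousOn_sum_log hsV).sub (continuousOn_sum_log hsW)).add
      (ContinuousOn.clog (ContinuousOn.div ?_ ?_ fun r hr => det_one_sub_smul_ne_zero hV hV1 hr)
        fun r hr => Or.inl (hq r hr))).sub continuousOn_const
    · exact (continuous_const.mul (Continuous.matrix_det (by fun_prop))).continuousOn
    · exact (Continuous.matrix_det (by fun_prop)).continuousOn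
  have hexp : ∀ r ∈ Set.Icc (0 : ℝ) 1, Complex.exp (F r) = 1 := fun r hr => by
    have hq0 : q r ≠ 0 := fun h0 => by simpa [h0] using hq r hr
    simp only [F, Complex.exp_sub, Complex.exp_add, exp_sum_log hsV hr, exp_sum_log hsW hr,
      Complex.exp_log hq0, Complex.exp_log ha, ← det_one_sub_smul_eq_prod]
    have h2 := det_one_sub_smul_ne_zero hV hV1 hr
    have h3 := det_one_sub_smul_ne_zero hW h1 hr
    simp only [q]
    field_simp
  have h01 := hF.eq_of_exp_eq_one hexp
  have hq1 : q 1 = 1 := by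
    simp only [q, Complex.ofReal_one, one_smul, ← det_one_sub_eq V h]
    exact div_self hV1
  have hq0 : q 0 = 1 - V 0 0 := by simp [q]
  simp only [F, hq1, hq0, Complex.ofReal_one, Complex.ofReal_zero, one_mul, zero_mul, sub_zero,
    Complex.log_one, Multiset.map_const', Multiset.sum_replicate, smul_zero, add_zero, zero_add,
    sub_self] at h01
  unfold logDetOneSub
  linear_combination h01

/-! ### Haar measure, and independence under Neretin's map. -/

instance unitaryGroupSecondCountable (n : ℕ) :
    SecondCountableTopology (Matrix.unitaryGroup (Fin n) ℂ) :=
  haveI : SecondCountableTopology (Matrix (Fin n) (Fin n) ℂ) :=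
    inferInstanceAs (SecondCountableTopology (Fin n → Fin n → ℂ))
  Topology.IsEmbedding.subtypeVal.secondCountableTopology

instance unitaryHaarIsMulRightInvariant (n : ℕ) : (unitaryHaar n).IsMulRightInvariant where
  map_mul_right_eq_self g := by
    have : IsProbabilityMeasure ((unitaryHaar n).map (· * g)) :=
      Measure.isProbabilityMeasure_map (measurable_mul_const g).aemeasurable
    exact Measure.isHaarMeasure_eq_of_isProbabilityMeasure _ _

theorem continuous_unitaryGroup_entry {n : ℕ} (i j : Fin n) :
    Continuous fun V : Matrix.unitaryGroup (Fin n) ℂ => V.1 i j :=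
  continuous_subtype_val.matrix_elem i j

theorem measurable_unitaryGroup_entry {n : ℕ} (i j : Fin n) :
    Measurable fun V : Matrix.unitaryGroup (Fin n) ℂ => V.1 i j :=
  (continuous_unitaryGroup_entry i j).measurable

theorem norm_unitaryGroup_entry_le {n : ℕ} (V : Matrix.unitaryGroup (Fin n) ℂ) (i j : Fin n) :
    ‖V.1 i j‖ ≤ 1 :=
  entry_norm_bound_of_unitary V.2 i j

/-- The scalar matrix `z`, as an element of the unitary group. -/
noncomputable def unitaryScalar (n : ℕ) (z : ℂ) (hz : ‖z‖ = 1) : Matrix.unitaryGroup (Fin n) ℂ :=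
  ⟨z • 1, by
    have h : star z * z = 1 := by
      rw [Complex.star_def, ← Complex.normSq_eq_conj_mul_self, Complex.normSq_eq_norm_sq, hz]
      simp
    rw [Matrix.mem_unitaryGroup_iff', star_smul, star_one, smul_mul_smul_comm, h, one_smul,
      Matrix.one_mul]⟩

theorem unitaryScalar_mul_apply {n : ℕ} {z : ℂ} (hz : ‖z‖ = 1)
    (V : Matrix.unitaryGroup (Fin n) ℂ) (i j : Fin n) :
    ((unitaryScalar n z hz * V : Matrix.unitaryGroup (Fin n) ℂ) : Matrix (Fin n) (Fin n) ℂ) i j =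
      z * V.1 i j := by
  simp [unitaryScalar]

/-- Multiplication by unimodular scalars gives the events `V i j = z k` equal measure. They are
infinitely many and disjoint in a probability space, so they are null. -/
theorem ae_entry_ne_one {n : ℕ} (i j : Fin n) :
    ∀ᵐ V : Matrix.unitaryGroup (Fin n) ℂ ∂unitaryHaar n, V.1 i j ≠ 1 := by
  let z : ℕ → ℂ := fun k => Complex.exp (((1 / ((k : ℝ) + 1) : ℝ) : ℂ) * Complex.I)
  have hz : ∀ k, ‖z k‖ = 1 := fun k => Complex.norm_exp_ofReal_mul_I _
  have hinj : Function.Injective z := fun k l hkl => by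
    have hb : ∀ k : ℕ, -Real.pi < 1 / ((k : ℝ) + 1) ∧ 1 / ((k : ℝ) + 1) ≤ Real.pi := fun k => by
      have h0 : (0 : ℝ) < 1 / ((k : ℝ) + 1) := by positivity
      have h1 : 1 / ((k : ℝ) + 1) ≤ 1 := by
        rw [div_le_one (by positivity)]
        linarith [(Nat.cast_nonneg k : (0 : ℝ) ≤ k)]
      constructor <;> linarith [Real.pi_gt_three]
    have him : ∀ k : ℕ, (((1 / ((k : ℝ) + 1) : ℝ) : ℂ) * Complex.I).im = 1 / ((k : ℝ) + 1) :=
      fun k => by rw [Complex.im_ofReal_mul, Complex.I_im, mul_one]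
    have := Complex.exp_inj_of_neg_pi_lt_of_le_pi (by rw [him]; exact (hb k).1)
      (by rw [him]; exact (hb k).2) (by rw [him]; exact (hb l).1) (by rw [him]; exact (hb l).2) hkl
    have h2 := mul_right_cancel₀ Complex.I_ne_zero this
    rw [Complex.ofReal_inj] at h2
    have h3 : (k : ℝ) + 1 = l + 1 := by
      simpa using h2
    exact_mod_cast add_right_cancel h3
  let S : ℂ → Set (Matrix.unitaryGroup (Fin n) ℂ) := fun w =>
    {V | V.1 i j = w}
  have hS : ∀ w, MeasurableSet (S w) := fun w =>
    measurable_unitaryGroup_entry i j (measurableSet_singleton w)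
  have hmeas : ∀ k, unitaryHaar n (S (z k)) = unitaryHaar n (S 1) := fun k => by
    rw [← measure_preimage_mul (unitaryHaar n) (unitaryScalar n (z k) (hz k)) (S (z k))]
    congr 1
    ext V
    have h0 : z k ≠ 0 := Complex.exp_ne_zero _
    simp only [S, Set.mem_preimage, Set.mem_ofPred_eq, unitaryScalar_mul_apply]
    exact mul_eq_left₀ h0
  by_contra hne
  have hpos : 0 < unitaryHaar n (S 1) := pos_iff_ne_zero.2 fun h0 => hne (by
    rw [ae_iff]
    simpa [S] using h0)
  have hfin := Measure.finite_const_le_meas_of_disjoint_iUnion (unitaryHaar n) hpos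
    (As := fun k => S (z k)) (fun k => hS _)
    (fun k l hkl => Set.disjoint_left.2 fun V hk hl => hkl (hinj (hk.symm.trans hl)))
    (measure_ne_top _ _)
  rw [show {k : ℕ | unitaryHaar n (S 1) ≤ unitaryHaar n (S (z k))} = Set.univ from
    Set.eq_univ_of_forall fun k => (hmeas k).ge] at hfin
  exact Set.infinite_univ hfin

/-- The block diagonal embedding `g ↦ 1 ⊕ g` of `U(n)` in `U(n+1)`. -/
def unitaryEmbed {n : ℕ} (g : Matrix.unitaryGroup (Fin n) ℂ) :
    Matrix.unitaryGroup (Fin (n + 1)) ℂ :=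
  ⟨Matrix.of fun i j => Fin.cases (Fin.cases 1 (fun _ => 0) j)
      (fun i' => Fin.cases 0 (fun j' => g.1 i' j') j) i, by
    rw [Matrix.mem_unitaryGroup_iff']
    have := Matrix.mem_unitaryGroup_iff'.1 g.2
    ext i j
    have h := fun i j => congrFun (congrFun this i) j
    simp only [Matrix.mul_apply, Matrix.star_apply] at h
    refine Fin.cases ?_ (fun i => ?_) i <;> refine Fin.cases ?_ (fun j => ?_) j <;>
      simp [Matrix.mul_apply, Fin.sum_univ_succ, Matrix.one_apply, (Fin.succ_ne_zero _).symm] <;>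
      simpa [Matrix.one_apply] using h i j⟩

theorem unitaryEmbed_mul_zero {n : ℕ} (g : Matrix.unitaryGroup (Fin n) ℂ)
    (V : Matrix.unitaryGroup (Fin (n + 1)) ℂ) (j : Fin (n + 1)) :
    (unitaryEmbed g * V).1 0 j = V.1 0 j := by
  simp [unitaryEmbed, Matrix.mul_apply, Fin.sum_univ_succ]

theorem unitaryEmbed_mul_succ {n : ℕ} (g : Matrix.unitaryGroup (Fin n) ℂ)
    (V : Matrix.unitaryGroup (Fin (n + 1)) ℂ) (i : Fin n) (j : Fin (n + 1)) :
    (unitaryEmbed g * V).1 i.succ j =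
      ∑ k : Fin n, g.1 i k * V.1 k.succ j := by
  simp [unitaryEmbed, Matrix.mul_apply, Fin.sum_univ_succ]

open scoped Classical in
/-- Neretin's map `U(n+1) → U(n)`, extended by `1` to the matrices with upper left entry `1`. -/
noncomputable def schurMap {n : ℕ} (V : Matrix.unitaryGroup (Fin (n + 1)) ℂ) :
    Matrix.unitaryGroup (Fin n) ℂ :=
  if h : V ∈ {V : Matrix.unitaryGroup (Fin (n + 1)) ℂ | V.1 0 0 ≠ 1} then
    ⟨schurCorner V, schurCorner_mem_unitaryGroup V.2 h⟩ else 1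

theorem coe_schurMap {n : ℕ} {V : Matrix.unitaryGroup (Fin (n + 1)) ℂ}
    (h : V.1 0 0 ≠ 1) : (schurMap V : Matrix (Fin n) (Fin n) ℂ) = schurCorner V := by
  have h' : V ∈ {V : Matrix.unitaryGroup (Fin (n + 1)) ℂ | V.1 0 0 ≠ 1} := h
  simp only [schurMap, dif_pos h']

theorem measurable_schurMap {n : ℕ} : Measurable (schurMap (n := n)) := by
  classical
  unfold schurMap
  refine Measurable.dite (s := {V : Matrix.unitaryGroup (Fin (n + 1)) ℂ | V.1 0 0 ≠ 1})
    (f := fun V : {V : Matrix.unitaryGroup (Fin (n + 1)) ℂ | V.1 0 0 ≠ 1} =>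
      (⟨schurCorner V.1.1, schurCorner_mem_unitaryGroup V.1.2 V.2⟩ : Matrix.unitaryGroup (Fin n) ℂ)) (g := fun _ => 1)
    ?_ measurable_const ?_
  · refine Continuous.measurable (Continuous.subtype_mk (continuous_matrix fun i j => ?_) _)
    have h : ∀ i j, Continuous fun V : {V : Matrix.unitaryGroup (Fin (n + 1)) ℂ |
        V.1 0 0 ≠ 1} => V.1 i j :=
      fun i j => (continuous_unitaryGroup_entry i j).comp continuous_subtype_val
    exact (h _ _).add (((h _ _).mul (h _ _)).div (continuous_const.sub (h _ _))
      fun V => sub_ne_zero.2 (Ne.symm V.2))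
  · exact (measurable_unitaryGroup_entry 0 0 (measurableSet_singleton 1)).compl

/-- Multiplying by `1 ⊕ g` on the left fixes row `0` and acts by `g` on the remaining rows, in which
Neretin's map is linear. -/
theorem schurMap_unitaryEmbed_mul {n : ℕ} (g : Matrix.unitaryGroup (Fin n) ℂ)
    {V : Matrix.unitaryGroup (Fin (n + 1)) ℂ} (h : V.1 0 0 ≠ 1) :
    schurMap (unitaryEmbed g * V) = g * schurMap V := by
  apply Subtype.ext
  have h' : (unitaryEmbed g * V).1 0 0 ≠ 1 := by
    rwa [unitaryEmbed_mul_zero]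
  rw [coe_schurMap h', show (g * schurMap V).1 = g.1 * (schurMap V).1 from rfl, coe_schurMap h]
  ext i j
  simp only [schurCorner, Matrix.of_apply, unitaryEmbed_mul_zero, unitaryEmbed_mul_succ,
    Matrix.mul_apply, mul_add, Finset.sum_add_distrib, Finset.sum_mul, Finset.sum_div]
  congr 1
  exact Finset.sum_congr rfl fun k _ => by ring

/-- Under the Haar measure the upper left entry and the image under Neretin's map are independent,
and the latter follows the Haar measure. -/
theorem integral_mul_schurMap {n : ℕ} {F : ℂ → ℂ} {G : Matrix.unitaryGroup (Fin n) ℂ → ℂ}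
    (hF : Measurable F) (hG : Measurable G) (hF1 : ∀ z, ‖F z‖ ≤ 1) (hG1 : ∀ g, ‖G g‖ ≤ 1) :
    ∫ V : Matrix.unitaryGroup _ ℂ, F (V.1 0 0) * G (schurMap V) ∂unitaryHaar (n + 1) =
      (∫ V : Matrix.unitaryGroup _ ℂ, F (V.1 0 0) ∂unitaryHaar (n + 1)) *
        ∫ g, G g ∂unitaryHaar n := by
  have hF' : Measurable fun V : Matrix.unitaryGroup (Fin (n + 1)) ℂ =>
      F (V.1 0 0) :=
    hF.comp (measurable_unitaryGroup_entry 0 0)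
  have h1 : ∀ g : Matrix.unitaryGroup (Fin n) ℂ,
      ∫ V : Matrix.unitaryGroup _ ℂ, F (V.1 0 0) * G (schurMap V)
        ∂unitaryHaar (n + 1) =
      ∫ V : Matrix.unitaryGroup _ ℂ, F (V.1 0 0) * G (g * schurMap V)
        ∂unitaryHaar (n + 1) := fun g => by
    rw [← integral_mul_left_eq_self _ (unitaryEmbed g)]
    refine integral_congr_ae ?_
    filter_upwards [ae_entry_ne_one (0 : Fin (n + 1)) 0] with V hV
    rw [schurMap_unitaryEmbed_mul g hV, unitaryEmbed_mul_zero]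
  -- Averaging over `g` and exchanging the integrals, the inner integral of `G (g * schurMap V)`
  -- over `g` does not depend on `V`, by right invariance.
  have h2 := integral_congr_ae (μ := unitaryHaar n) (Eventually.of_forall h1)
  rw [integral_const, probReal_univ, one_smul] at h2
  rw [h2, integral_integral_swap]
  · rw [← integral_mul_const]
    refine integral_congr_ae (Eventually.of_forall fun V => ?_)
    simp only
    rw [integral_const_mul, integral_mul_right_eq_self G (schurMap V)]
  · refine Integrable.of_bound (C := 1) (Measurable.aestronglyMeasurable ?_)
      (Eventually.of_forall fun p => ?_)
    · exact (hF'.comp measurable_snd).mul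
        (hG.comp (measurable_fst.mul (measurable_schurMap.comp measurable_snd)))
    · simp only [Function.uncurry, norm_mul]
      exact mul_le_one₀ (hF1 _) (norm_nonneg _) (hG1 _)

theorem measurePreserving_schurMap (n : ℕ) :
    MeasurePreserving (schurMap (n := n)) (unitaryHaar (n + 1)) (unitaryHaar n) := by
  refine ⟨measurable_schurMap, ?_⟩
  have : IsProbabilityMeasure ((unitaryHaar (n + 1)).map (schurMap (n := n))) :=
    Measure.isProbabilityMeasure_map measurable_schurMap.aemeasurable
  ext s hs
  rw [Measure.map_apply measurable_schurMap hs, ← measureReal_eq_measureReal_iff]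
  have h := integral_mul_schurMap (n := n) (F := fun _ => 1)
    (G := s.indicator fun _ => 1) measurable_const (measurable_const.indicator hs) (by simp)
    (fun g => by by_cases hg : g ∈ s <;> simp [hg])
  simp only [one_mul, integral_const, probReal_univ, one_smul] at h
  rw [integral_indicator_const _ hs] at h
  have h2 : (fun V : Matrix.unitaryGroup (Fin (n + 1)) ℂ =>
      s.indicator (fun _ => (1 : ℂ)) (schurMap V)) =
      (schurMap ⁻¹' s).indicator fun _ => 1 := rfl
  rw [h2, integral_indicator_const _ (measurable_schurMap hs)] at h
  simpa using h

/-- A measurable version of `logDetOneSub` on the unitary group. -/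
noncomputable def logDetRec : ∀ n : ℕ, Matrix.unitaryGroup (Fin n) ℂ → ℂ
  | 0, _ => 0
  | n + 1, V => Complex.log (1 - V.1 0 0) +
      logDetRec n (schurMap V)

theorem measurable_logDetRec : ∀ n, Measurable (logDetRec n)
  | 0 => measurable_const
  | n + 1 => (Complex.measurable_log.comp ((measurable_unitaryGroup_entry 0 0).const_sub 1)).add
      ((measurable_logDetRec n).comp measurable_schurMap)

/-- The nonvanishing of the determinant is carried through the induction because the splitting of
the logarithm needs it for the smaller matrix. -/
theorem ae_logDetOneSub_eq (n : ℕ) : ∀ᵐ V : Matrix.unitaryGroup (Fin n) ℂ ∂unitaryHaar n,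
    (1 - V.1).det ≠ 0 ∧
      logDetOneSub V.1 = logDetRec n V := by
  induction n with
  | zero => exact Eventually.of_forall fun V => by simp [logDetOneSub, logDetRec]
  | succ n ih =>
    filter_upwards [ae_entry_ne_one (0 : Fin (n + 1)) 0,
      (measurePreserving_schurMap n).quasiMeasurePreserving.ae ih] with V hV hW
    rw [coe_schurMap hV] at hW
    refine ⟨?_, ?_⟩
    · rw [det_one_sub_eq _ hV]
      exact mul_ne_zero (sub_ne_zero.2 hV.symm) hW.1
    · rw [logDetOneSub_eq_log_add V.2 hV hW.1, hW.2, logDetRec]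

open Complex in
theorem integral_exp_logDetRec (ξ : ℂ) (n : ℕ) :
    ∫ V, exp ((inner ℝ (logDetRec n V) ξ : ℝ) * I) ∂unitaryHaar n =
      ∏ k ∈ Finset.range n, ∫ V : Matrix.unitaryGroup _ ℂ, exp ((inner ℝ
        (log (1 - V.1 0 0)) ξ : ℝ) * I)
          ∂unitaryHaar (k + 1) := by
  induction n with
  | zero => simp [logDetRec]
  | succ n ih =>
    rw [Finset.prod_range_succ, mul_comm, ← ih, ← integral_mul_schurMap
      (F := fun z => exp ((inner ℝ (log (1 - z)) ξ : ℝ) * I))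
      (G := fun V => exp ((inner ℝ (logDetRec n V) ξ : ℝ) * I))]
    · simp only [logDetRec, inner_add_left, ofReal_add, add_mul, exp_add]
    · have : Measurable fun z : ℂ => log (1 - z) :=
        Complex.measurable_log.comp (measurable_const.sub measurable_id)
      fun_prop
    · have := measurable_logDetRec n
      fun_prop
    · exact fun z => (norm_exp_ofReal_mul_I _).le
    · exact fun z => (norm_exp_ofReal_mul_I _).le

/-! ### Moments of a single entry. -/

/-- The Householder reflection in the direction `e i + 2 ω e j`. -/
noncomputable def householder {n : ℕ} {i j : Fin n} (hij : i ≠ j) {ω : ℂ} (hω : ‖ω‖ = 1) :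
    Matrix.unitaryGroup (Fin n) ℂ :=
  ⟨1 - (2 / 5 : ℂ) • Matrix.vecMulVec (Pi.single i 1 + Pi.single j (2 * ω))
      (star (Pi.single i 1 + Pi.single j (2 * ω))), by
    set v : Fin n → ℂ := Pi.single i 1 + Pi.single j (2 * ω) with hv
    have hω' : star ω * ω = 1 := by
      rw [Complex.star_def, ← Complex.normSq_eq_conj_mul_self, Complex.normSq_eq_norm_sq, hω]
      simp
    have h5 : star v ⬝ᵥ v = 5 := by
      rw [hv, dotProduct_add, dotProduct_single, dotProduct_single]
      simp only [Complex.star_def] at hω'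
      simp [hij, hij.symm]
      linear_combination 4 * hω'
    have hs : star (1 - (2 / 5 : ℂ) • Matrix.vecMulVec v (star v)) =
        1 - (2 / 5 : ℂ) • Matrix.vecMulVec v (star v) := by
      rw [Matrix.star_eq_conjTranspose]
      simp [Matrix.conjTranspose_vecMulVec]
    rw [Matrix.mem_unitaryGroup_iff', hs, sub_mul, mul_sub, mul_sub, smul_mul_smul_comm,
      Matrix.vecMulVec_mul_vecMulVec, h5, Matrix.mul_one, Matrix.one_mul, Matrix.mul_one,
      Matrix.vecMulVec_smul, smul_smul]
    module⟩

theorem householder_mul_apply {n : ℕ} {i j : Fin n} (hij : i ≠ j) {ω : ℂ} (hω : ‖ω‖ = 1)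
    (V : Matrix.unitaryGroup (Fin n) ℂ) (l : Fin n) :
    (householder hij hω * V).1 i l = 3 / 5 * V.1 i l - 4 / 5 * (star ω * V.1 j l) := by
  simp only [householder, Submonoid.coe_mul, sub_mul, Matrix.one_mul, Matrix.sub_apply,
    Matrix.smul_mul, Matrix.smul_apply, Matrix.vecMulVec_mul, Matrix.vecMulVec_apply, star_add,
    Matrix.add_vecMul, Pi.add_apply]
  simp [Matrix.vecMul, hij, Pi.star_single]
  ring

theorem integral_householder {n : ℕ} {i j : Fin n} (hij : i ≠ j) {ω : ℂ} (hω : ‖ω‖ = 1) (l : Fin n)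
    (f : ℂ → ℝ) :
    ∫ V, f (3 / 5 * V.1 i l - 4 / 5 * (ω * V.1 j l)) ∂unitaryHaar n =
      ∫ V, f (V.1 i l) ∂unitaryHaar n := by
  have hω' : ‖star ω‖ = 1 := by rwa [norm_star]
  rw [← integral_mul_left_eq_self (fun V => f (V.1 i l)) (householder hij hω')]
  simp only [householder_mul_apply, star_star]

theorem Continuous.integrable_unitaryHaar {n : ℕ} {E : Type*} [NormedAddCommGroup E]
    {f : Matrix.unitaryGroup (Fin n) ℂ → E} (hf : Continuous f) : Integrable f (unitaryHaar n) :=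
  hf.integrable_of_hasCompactSupport (HasCompactSupport.of_compactSpace f)

theorem continuous_normSq_entry {n : ℕ} (i l : Fin n) :
    Continuous fun V : Matrix.unitaryGroup (Fin n) ℂ => Complex.normSq (V.1 i l) :=
  Complex.continuous_normSq.comp (continuous_unitaryGroup_entry i l)

theorem normSq_add_normSq_neg (a b : ℂ) :
    Complex.normSq (3 / 5 * a - 4 / 5 * (1 * b)) + Complex.normSq (3 / 5 * a - 4 / 5 * (-1 * b)) =
      18 / 25 * Complex.normSq a + 32 / 25 * Complex.normSq b := by
  rw [show (3 / 5 : ℂ) = ((3 / 5 : ℝ) : ℂ) by push_cast; rfl,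
    show (4 / 5 : ℂ) = ((4 / 5 : ℝ) : ℂ) by push_cast; rfl]
  simp [Complex.normSq_apply]
  ring

/-- Summing over the fourth roots of unity removes every term depending on the relative phase of `a`
and `b`. -/
theorem normSq_sq_add_rotations (a b : ℂ) :
    Complex.normSq (3 / 5 * a - 4 / 5 * (1 * b)) ^ 2 +
      Complex.normSq (3 / 5 * a - 4 / 5 * (-1 * b)) ^ 2 +
      Complex.normSq (3 / 5 * a - 4 / 5 * (Complex.I * b)) ^ 2 +
      Complex.normSq (3 / 5 * a - 4 / 5 * (-Complex.I * b)) ^ 2 =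
    4 / 625 * (81 * Complex.normSq a ^ 2 + 256 * Complex.normSq b ^ 2 +
      576 * (Complex.normSq a * Complex.normSq b)) := by
  rw [show (3 / 5 : ℂ) = ((3 / 5 : ℝ) : ℂ) by push_cast; rfl,
    show (4 / 5 : ℂ) = ((4 / 5 : ℝ) : ℂ) by push_cast; rfl]
  simp [Complex.normSq_apply]
  ring

theorem integral_normSq_entry_eq {n : ℕ} (i j l : Fin n) :
    ∫ V, Complex.normSq (V.1 i l) ∂unitaryHaar n = ∫ V, Complex.normSq (V.1 j l) ∂unitaryHaar n := by
  by_cases hij : i = j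
  · rw [hij]
  have hc : ∀ ω : ℂ, Continuous fun V : Matrix.unitaryGroup (Fin n) ℂ =>
      Complex.normSq (3 / 5 * V.1 i l - 4 / 5 * (ω * V.1 j l)) := fun ω =>
    Complex.continuous_normSq.comp ((continuous_const.mul (continuous_unitaryGroup_entry i l)).sub
      (continuous_const.mul (continuous_const.mul (continuous_unitaryGroup_entry j l))))
  have h1 := integral_householder hij (ω := 1) (by simp) l Complex.normSq
  have h2 := integral_householder hij (ω := -1) (by simp) l Complex.normSq
  have h3 := congrArg₂ (HAdd.hAdd : ℝ → ℝ → ℝ) h1 h2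
  rw [← integral_add (hc 1).integrable_unitaryHaar (hc (-1)).integrable_unitaryHaar] at h3
  simp only [normSq_add_normSq_neg] at h3
  rw [integral_add ((continuous_normSq_entry i l).integrable_unitaryHaar.const_mul _)
    ((continuous_normSq_entry j l).integrable_unitaryHaar.const_mul _), integral_const_mul,
    integral_const_mul] at h3
  linarith

theorem sum_normSq_column {n : ℕ} (V : Matrix.unitaryGroup (Fin n) ℂ) (l : Fin n) :
    ∑ i, Complex.normSq (V.1 i l) = 1 := by
  have := congrFun (congrFun (Matrix.mem_unitaryGroup_iff'.1 V.2) l) l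
  rw [Matrix.mul_apply, Matrix.one_apply_eq] at this
  have h2 := congrArg Complex.re this
  simpa [Complex.normSq_apply] using h2

theorem integral_normSq_entry {n : ℕ} (i l : Fin n) :
    ∫ V, Complex.normSq (V.1 i l) ∂unitaryHaar n = 1 / n := by
  have h : ∫ V, ∑ j, Complex.normSq (V.1 j l) ∂unitaryHaar n = 1 := by
    simp [sum_normSq_column]
  rw [integral_finsetSum _ fun j _ => (continuous_normSq_entry j l).integrable_unitaryHaar] at h
  simp only [fun j => integral_normSq_entry_eq j i l, Finset.sum_const, Finset.card_univ,
    Fintype.card_fin, nsmul_eq_mul] at h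
  have hn : (n : ℝ) ≠ 0 := fun h0 => by simp [h0] at h
  field_simp
  linarith

theorem integral_normSq_sq_relation {n : ℕ} {i j : Fin n} (hij : i ≠ j) (l : Fin n) :
    81 * ∫ V, Complex.normSq (V.1 i l) ^ 2 ∂unitaryHaar n +
      256 * ∫ V, Complex.normSq (V.1 j l) ^ 2 ∂unitaryHaar n +
      576 * ∫ V, Complex.normSq (V.1 i l) * Complex.normSq (V.1 j l) ∂unitaryHaar n =
    625 * ∫ V, Complex.normSq (V.1 i l) ^ 2 ∂unitaryHaar n := by
  have hc : ∀ ω : ℂ, Integrable (fun V : Matrix.unitaryGroup (Fin n) ℂ =>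
      Complex.normSq (3 / 5 * V.1 i l - 4 / 5 * (ω * V.1 j l)) ^ 2) (unitaryHaar n) := fun ω =>
    ((Complex.continuous_normSq.comp ((continuous_const.mul
      (continuous_unitaryGroup_entry i l)).sub
      (continuous_const.mul (continuous_const.mul
        (continuous_unitaryGroup_entry j l))))).pow 2).integrable_unitaryHaar
  have hω : ∀ {ω : ℂ}, ‖ω‖ = 1 → _ := fun {ω} hω =>
    integral_householder hij (ω := ω) hω l fun z => Complex.normSq z ^ 2
  have h1 := hω (ω := 1) (by simp)
  have h2 := hω (ω := -1) (by simp)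
  have h3 := hω (ω := Complex.I) (by simp)
  have h4 := hω (ω := -Complex.I) (by simp)
  have hc2 : ∀ ω ω' : ℂ, Integrable (fun V : Matrix.unitaryGroup (Fin n) ℂ =>
      Complex.normSq (3 / 5 * V.1 i l - 4 / 5 * (ω * V.1 j l)) ^ 2 +
        Complex.normSq (3 / 5 * V.1 i l - 4 / 5 * (ω' * V.1 j l)) ^ 2) (unitaryHaar n) :=
    fun ω ω' => (hc ω).add (hc ω')
  have h5 := congrArg₂ (HAdd.hAdd : ℝ → ℝ → ℝ) (congrArg₂ (HAdd.hAdd : ℝ → ℝ → ℝ) h1 h2)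
    (congrArg₂ (HAdd.hAdd : ℝ → ℝ → ℝ) h3 h4)
  rw [← integral_add (hc _) (hc _), ← integral_add (hc _) (hc _),
    ← integral_add (hc2 _ _) (hc2 _ _)] at h5
  simp only [← add_assoc] at h5
  simp only [normSq_sq_add_rotations] at h5
  have hi : ∀ i, Integrable (fun V : Matrix.unitaryGroup (Fin n) ℂ =>
      Complex.normSq (V.1 i l) ^ 2) (unitaryHaar n) := fun i =>
    ((continuous_normSq_entry i l).pow 2).integrable_unitaryHaar
  have hm : Integrable (fun V : Matrix.unitaryGroup (Fin n) ℂ =>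
      Complex.normSq (V.1 i l) * Complex.normSq (V.1 j l)) (unitaryHaar n) :=
    ((continuous_normSq_entry i l).mul (continuous_normSq_entry j l)).integrable_unitaryHaar
  have hij' : Integrable (fun V : Matrix.unitaryGroup (Fin n) ℂ =>
      81 * Complex.normSq (V.1 i l) ^ 2 + 256 * Complex.normSq (V.1 j l) ^ 2) (unitaryHaar n) :=
    ((hi i).const_mul _).add ((hi j).const_mul _)
  rw [integral_const_mul, integral_add hij' (hm.const_mul _),
    integral_add ((hi i).const_mul _) ((hi j).const_mul _), integral_const_mul, integral_const_mul,
    integral_const_mul] at h5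
  linarith

/-- The relation and its copy with `i` and `j` exchanged are two linear equations: they force equal
fourth moments, then the mixed moment. -/
theorem integral_normSq_entry_mul {n : ℕ} {i j : Fin n} (hij : i ≠ j) (l : Fin n) :
    ∫ V, Complex.normSq (V.1 i l) * Complex.normSq (V.1 j l) ∂unitaryHaar n =
      (∫ V, Complex.normSq (V.1 i l) ^ 2 ∂unitaryHaar n) / 2 := by
  have h1 := integral_normSq_sq_relation hij l
  have h2 := integral_normSq_sq_relation hij.symm l
  simp only [fun V : Matrix.unitaryGroup (Fin n) ℂ =>
    mul_comm (Complex.normSq (V.1 j l)) (Complex.normSq (V.1 i l))] at h2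
  linarith

theorem integral_normSq_entry_sq {n : ℕ} (i l : Fin n) :
    ∫ V, Complex.normSq (V.1 i l) ^ 2 ∂unitaryHaar n = 2 / (n * (n + 1)) := by
  have h : ∫ V, ∑ j, Complex.normSq (V.1 i l) * Complex.normSq (V.1 j l) ∂unitaryHaar n = 1 / n := by
    simp only [← Finset.mul_sum, sum_normSq_column, mul_one, integral_normSq_entry]
  have hint : ∀ j, Integrable (fun V : Matrix.unitaryGroup (Fin n) ℂ =>
      Complex.normSq (V.1 i l) * Complex.normSq (V.1 j l)) (unitaryHaar n) := fun j =>
    ((continuous_normSq_entry i l).mul (continuous_normSq_entry j l)).integrable_unitaryHaar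
  rw [integral_finsetSum _ fun j _ => hint j, ← Finset.add_sum_erase _ _ (Finset.mem_univ i)] at h
  rw [Finset.sum_congr rfl fun j hj => integral_normSq_entry_mul (Finset.ne_of_mem_erase hj).symm l,
    Finset.sum_const, Finset.card_erase_of_mem (Finset.mem_univ i), Finset.card_univ,
    Fintype.card_fin, nsmul_eq_mul] at h
  simp only [← sq] at h
  have hn : 0 < n := i.pos
  rw [Nat.cast_sub hn, Nat.cast_one] at h
  have hn' : (0 : ℝ) < n := by exact_mod_cast hn
  field_simp at h ⊢
  linarith

theorem integral_entry_pow_mul_conj_pow {n : ℕ} (i l : Fin n) {p q : ℕ} (hpq : p ≠ q) :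
    ∫ V, V.1 i l ^ p * star (V.1 i l ^ q) ∂unitaryHaar n = 0 := by
  -- With this angle `p t` and `q t` lie in `[0, 1]`, where `θ ↦ exp (i θ)` is injective.
  -- Multiplying `V` by the scalar `z` therefore multiplies the integral by a number other than `1`.
  let t : ℝ := 1 / (p + q + 1)
  let z : ℂ := Complex.exp (t * Complex.I)
  have hz : ‖z‖ = 1 := Complex.norm_exp_ofReal_mul_I _
  have hzpq : z ^ p * star (z ^ q) ≠ 1 := fun h => by
    have h0 : star (z ^ q) * z ^ q = 1 := by
      rw [Complex.star_def, ← Complex.normSq_eq_conj_mul_self, Complex.normSq_eq_norm_sq, norm_pow, hz]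
      simp
    have h1 : z ^ p = z ^ q := by
      calc z ^ p = z ^ p * (star (z ^ q) * z ^ q) := by rw [h0, mul_one]
        _ = z ^ q := by rw [← mul_assoc, h, one_mul]
    simp only [z, ← Complex.exp_nat_mul] at h1
    have hb : ∀ m : ℕ, m ≤ p + q → -Real.pi < ((m : ℂ) * (t * Complex.I)).im ∧
        ((m : ℂ) * (t * Complex.I)).im ≤ Real.pi := fun m hm => by
      have e : ((m : ℂ) * (t * Complex.I)).im = m * t := by
        rw [← mul_assoc, ← Complex.ofReal_natCast, ← Complex.ofReal_mul, Complex.im_ofReal_mul,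
          Complex.I_im, mul_one]
      have h0 : (0 : ℝ) ≤ m * t := by positivity
      have h1 : (m : ℝ) * t ≤ 1 := by
        have : (m : ℝ) ≤ p + q := by exact_mod_cast hm
        simp only [t]
        rw [mul_one_div, div_le_one (by positivity)]
        linarith
      rw [e]
      constructor <;> linarith [Real.pi_gt_three]
    have h2 := Complex.exp_inj_of_neg_pi_lt_of_le_pi (hb p (by omega)).1 (hb p (by omega)).2
      (hb q (by omega)).1 (hb q (by omega)).2 h1
    have ht : (t : ℂ) * Complex.I ≠ 0 := mul_ne_zero
      (Complex.ofReal_ne_zero.2 (by simp only [t]; positivity)) Complex.I_ne_zero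
    exact hpq (by exact_mod_cast mul_right_cancel₀ ht h2)
  have h := integral_mul_left_eq_self (μ := unitaryHaar n)
    (fun V : Matrix.unitaryGroup (Fin n) ℂ => V.1 i l ^ p * star (V.1 i l ^ q)) (unitaryScalar n z hz)
  simp only [unitaryScalar_mul_apply] at h
  simp only [mul_pow, star_mul', mul_mul_mul_comm] at h
  rw [integral_const_mul] at h
  by_contra h0
  exact hzpq (mul_right_cancel₀ h0 (by rw [h, one_mul]))

/-! ### The logarithm of `1 - a` for `a` in the closed disc with orthogonal powers. -/

open scoped Topology ENNReal in
theorem lintegral_sq_norm_le_of_tendsto {Ω : Type*} [MeasurableSpace Ω] {μ : Measure Ω}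
    {f : ℕ → Ω → ℂ} {g : Ω → ℂ} (hf : ∀ n, Measurable (f n))
    (hfg : ∀ᵐ ω ∂μ, Tendsto (fun n => f n ω) atTop (𝓝 (g ω))) {C : ℝ≥0∞}
    (hC : ∀ n, ∫⁻ ω, ENNReal.ofReal (‖f n ω‖ ^ 2) ∂μ ≤ C) :
    ∫⁻ ω, ENNReal.ofReal (‖g ω‖ ^ 2) ∂μ ≤ C := by
  calc ∫⁻ ω, ENNReal.ofReal (‖g ω‖ ^ 2) ∂μ
      = ∫⁻ ω, liminf (fun n => ENNReal.ofReal (‖f n ω‖ ^ 2)) atTop ∂μ := by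
        refine lintegral_congr_ae ?_
        filter_upwards [hfg] with ω hω
        exact (Tendsto.liminf_eq (ENNReal.tendsto_ofReal (hω.norm.pow 2))).symm
    _ ≤ liminf (fun n => ∫⁻ ω, ENNReal.ofReal (‖f n ω‖ ^ 2) ∂μ) atTop :=
        lintegral_liminf_le fun n => ((hf n).norm.pow_const 2).ennreal_ofReal
    _ ≤ C := liminf_le_of_frequently_le' (Frequently.of_forall hC)

section RotationInvariant

variable {Ω : Type*} [MeasurableSpace Ω] {μ : Measure Ω} [IsProbabilityMeasure μ] {a : Ω → ℂ}

theorem integrable_pow_of_norm_le_one (ha : Measurable a) (ha1 : ∀ ω, ‖a ω‖ ≤ 1) (n : ℕ) :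
    Integrable (fun ω => a ω ^ n) μ :=
  Integrable.of_bound (C := 1) (ha.pow_const n).aestronglyMeasurable
    (Eventually.of_forall fun ω => by
      rw [norm_pow]; exact pow_le_one₀ (norm_nonneg _) (ha1 ω))

theorem integrable_norm_pow_of_norm_le_one (ha : Measurable a) (ha1 : ∀ ω, ‖a ω‖ ≤ 1) (n : ℕ) :
    Integrable (fun ω => ‖a ω‖ ^ n) μ := by
  simpa only [norm_pow] using (integrable_pow_of_norm_le_one ha ha1 n).norm

theorem integral_sq_norm_sum_mul_pow (ha : Measurable a) (ha1 : ∀ ω, ‖a ω‖ ≤ 1)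
    (horth : ∀ p q : ℕ, p ≠ q → ∫ ω, a ω ^ p * star (a ω ^ q) ∂μ = 0) (s : Finset ℕ) (c : ℕ → ℂ) :
    ∫ ω, ‖∑ m ∈ s, c m * a ω ^ m‖ ^ 2 ∂μ = ∑ m ∈ s, ‖c m‖ ^ 2 * ∫ ω, ‖a ω‖ ^ (2 * m) ∂μ := by
  have hint : ∀ p q : ℕ, Integrable (fun ω => a ω ^ p * star (a ω ^ q)) μ := fun p q =>
    Integrable.of_bound (C := 1) ((ha.pow_const p).mul
      (continuous_star.measurable.comp (ha.pow_const q))).aestronglyMeasurable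
      (Eventually.of_forall fun ω => by
        rw [norm_mul, norm_star, norm_pow, norm_pow]
        exact mul_le_one₀ (pow_le_one₀ (norm_nonneg _) (ha1 ω)) (by positivity)
          (pow_le_one₀ (norm_nonneg _) (ha1 ω)))
  have hsq : ∀ z : ℂ, ((‖z‖ ^ 2 : ℝ) : ℂ) = z * star z := fun z => by
    rw [Complex.star_def, Complex.mul_conj', Complex.ofReal_pow]
  apply Complex.ofReal_injective
  rw [← integral_complex_ofReal]
  have hexp : ∀ ω, ((‖∑ m ∈ s, c m * a ω ^ m‖ ^ 2 : ℝ) : ℂ) =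
      ∑ p ∈ s, ∑ q ∈ s, c p * star (c q) * (a ω ^ p * star (a ω ^ q)) := fun ω => by
    rw [hsq, star_sum, Finset.sum_mul_sum]
    refine Finset.sum_congr rfl fun p _ => Finset.sum_congr rfl fun q _ => ?_
    rw [star_mul']
    ring
  simp only [hexp]
  rw [integral_finsetSum _ fun p _ => integrable_finsetSum _ fun q _ => (hint p q).const_mul _,
    Complex.ofReal_sum]
  refine Finset.sum_congr rfl fun p hp => ?_
  rw [integral_finsetSum _ fun q _ => (hint p q).const_mul _, Finset.sum_eq_single p]
  · rw [integral_const_mul, ← hsq, Complex.ofReal_mul, ← integral_complex_ofReal]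
    congr 1
    refine integral_congr_ae (Eventually.of_forall fun ω => ?_)
    simp only [← hsq, norm_pow, ← pow_mul, mul_comm]
  · intro q _ hq
    rw [integral_const_mul, horth p q hq.symm, mul_zero]
  · exact fun h => absurd hp h

/-- Only exponents `m ≥ 2` occur, so each `E|a|^(2m)` is at most `E|a|⁴`, and `∑_{m > M} m⁻² ≤ 1/M`.
The bound is uniform in `K` and `r`, ready for Fatou's lemma. -/
theorem lintegral_sq_norm_sum_Ioc_le (ha : Measurable a) (ha1 : ∀ ω, ‖a ω‖ ≤ 1)
    (horth : ∀ p q : ℕ, p ≠ q → ∫ ω, a ω ^ p * star (a ω ^ q) ∂μ = 0) {M K : ℕ} (hM : 1 ≤ M)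
    (hMK : M ≤ K) {r : ℝ} (hr0 : 0 ≤ r) (hr1 : r ≤ 1) :
    ∫⁻ ω, ENNReal.ofReal (‖∑ m ∈ Finset.Ioc M K, ((r : ℂ) * a ω) ^ m / m‖ ^ 2) ∂μ ≤
      ENNReal.ofReal ((∫ ω, ‖a ω‖ ^ 4 ∂μ) / M) := by
  have hb : ∀ ω, ‖∑ m ∈ Finset.Ioc M K, ((r : ℂ) * a ω) ^ m / m‖ ^ 2 =
      ‖∑ m ∈ Finset.Ioc M K, ((r : ℂ) ^ m / m) * a ω ^ m‖ ^ 2 := fun ω => by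
    congr 2
    exact Finset.sum_congr rfl fun m _ => by rw [mul_pow]; ring
  have hint : Integrable (fun ω => ‖∑ m ∈ Finset.Ioc M K, ((r : ℂ) ^ m / m) * a ω ^ m‖ ^ 2) μ := by
    refine Integrable.of_bound (C := (∑ m ∈ Finset.Ioc M K, ‖((r : ℂ) ^ m / m)‖) ^ 2)
      (Measurable.aestronglyMeasurable (by fun_prop)) (Eventually.of_forall fun ω => ?_)
    rw [norm_pow, norm_norm]
    gcongr
    refine (norm_sum_le _ _).trans (Finset.sum_le_sum fun m _ => ?_)
    rw [norm_mul, norm_pow]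
    exact mul_le_of_le_one_right (norm_nonneg _) (pow_le_one₀ (norm_nonneg _) (ha1 ω))
  simp only [hb]
  rw [← ofReal_integral_eq_lintegral_ofReal hint (Eventually.of_forall fun ω => by positivity)]
  refine ENNReal.ofReal_le_ofReal ?_
  rw [integral_sq_norm_sum_mul_pow ha ha1 horth]
  have hQ : 0 ≤ ∫ ω, ‖a ω‖ ^ 4 ∂μ := integral_nonneg fun ω => by positivity
  calc ∑ m ∈ Finset.Ioc M K, ‖(r : ℂ) ^ m / m‖ ^ 2 * ∫ ω, ‖a ω‖ ^ (2 * m) ∂μ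
      ≤ ∑ m ∈ Finset.Ioc M K, ((m : ℝ) ^ 2)⁻¹ * ∫ ω, ‖a ω‖ ^ 4 ∂μ := by
        refine Finset.sum_le_sum fun m hm => ?_
        have hm2 : 2 ≤ m := by have := (Finset.mem_Ioc.1 hm).1; omega
        refine mul_le_mul ?_ (integral_mono (integrable_norm_pow_of_norm_le_one ha ha1 _)
          (integrable_norm_pow_of_norm_le_one ha ha1 _) fun ω =>
            pow_le_pow_of_le_one (norm_nonneg _) (ha1 ω) (by omega))
          (integral_nonneg fun ω => by positivity) (by positivity)
        rw [norm_div, norm_pow, Complex.norm_natCast, Complex.norm_real, Real.norm_of_nonneg hr0,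
          div_pow, div_eq_inv_mul]
        exact mul_le_of_le_one_right (by positivity) (pow_le_one₀ (by positivity)
          (pow_le_one₀ hr0 hr1))
    _ = (∑ m ∈ Finset.Ioc M K, ((m : ℝ) ^ 2)⁻¹) * ∫ ω, ‖a ω‖ ^ 4 ∂μ := by rw [Finset.sum_mul]
    _ ≤ (M : ℝ)⁻¹ * ∫ ω, ‖a ω‖ ^ 4 ∂μ := by
        refine mul_le_mul_of_nonneg_right ?_ hQ
        refine (sum_Ioc_inv_sq_le_sub (by omega) hMK).trans ?_
        have : (0 : ℝ) ≤ (K : ℝ)⁻¹ := by positivity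
        linarith
    _ = (∫ ω, ‖a ω‖ ^ 4 ∂μ) / M := by rw [div_eq_inv_mul]

/-- The remainder of order `M` in the Taylor expansion of `log (1 - z)` at `0`. -/
noncomputable def logRemainder (M : ℕ) (z : ℂ) : ℂ :=
  Complex.log (1 - z) + ∑ m ∈ Finset.range (M + 1), z ^ m / m

theorem measurable_logRemainder (M : ℕ) : Measurable (logRemainder M) := by
  have : Measurable fun z : ℂ => Complex.log (1 - z) :=
    Complex.measurable_log.comp (measurable_const.sub measurable_id)
  unfold logRemainder
  fun_prop

open scoped Topology in
theorem tendsto_sum_Ioc_logRemainder (M : ℕ) {z : ℂ} (hz : ‖z‖ < 1) :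
    Tendsto (fun k => -∑ m ∈ Finset.Ioc M (M + k), z ^ m / m) atTop (𝓝 (logRemainder M z)) := by
  have h := ((Complex.hasSum_taylorSeries_neg_log hz).tendsto_sum_nat.comp
    (tendsto_add_atTop_nat (M + 1))).neg.add_const (∑ m ∈ Finset.range (M + 1), z ^ m / m)
  rw [neg_neg] at h
  refine h.congr fun k => ?_
  have hI : Finset.Ioc M (M + k) = Finset.Ico (M + 1) (k + (M + 1)) := by
    ext m; simp only [Finset.mem_Ioc, Finset.mem_Ico]; omega
  rw [hI, Finset.sum_Ico_eq_sub _ (by omega)]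
  simp only [Function.comp]
  ring

theorem lintegral_sq_norm_logRemainder_le (ha : Measurable a) (ha1 : ∀ ω, ‖a ω‖ ≤ 1)
    (hne : ∀ᵐ ω ∂μ, a ω ≠ 1)
    (horth : ∀ p q : ℕ, p ≠ q → ∫ ω, a ω ^ p * star (a ω ^ q) ∂μ = 0) {M : ℕ} (hM : 1 ≤ M) :
    ∫⁻ ω, ENNReal.ofReal (‖logRemainder M (a ω)‖ ^ 2) ∂μ ≤
      ENNReal.ofReal ((∫ ω, ‖a ω‖ ^ 4 ∂μ) / M) := by
  -- As `|a|` may equal `1`, the Taylor series is used only at `r n * a`. Fatou's lemma is applied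
  -- twice: to the partial sums for fixed `n`, then to the radial limit `r n → 1`.
  let r : ℕ → ℝ := fun n => 1 - 1 / ((n : ℝ) + 1)
  have hr : Tendsto r atTop (nhds 1) := by
    simpa [r] using (tendsto_const_nhds (x := (1 : ℝ))).sub
      (tendsto_one_div_add_atTop_nhds_zero_nat (𝕜 := ℝ))
  have hr0 : ∀ n, 0 ≤ r n := fun n => by
    simp only [r, sub_nonneg]
    rw [div_le_one (by positivity)]
    linarith [(Nat.cast_nonneg n : (0 : ℝ) ≤ n)]
  have hr1 : ∀ n, r n < 1 := fun n => by
    simp only [r]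
    linarith [(by positivity : (0 : ℝ) < 1 / ((n : ℝ) + 1))]
  refine lintegral_sq_norm_le_of_tendsto
    (f := fun n ω => logRemainder M ((r n : ℂ) * a ω))
    (fun n => (measurable_logRemainder M).comp (ha.const_mul _)) ?_ fun n => ?_
  · filter_upwards [hne] with ω hω
    have hc : ContinuousAt (logRemainder M) (a ω) := by
      have hre : (1 - a ω) ∈ Complex.slitPlane := by
        left
        rw [Complex.sub_re, Complex.one_re, sub_pos]
        rcases (ha1 ω).lt_or_eq with h | h
        · exact (Complex.re_le_norm _).trans_lt h
        · exact re_lt_one_of_norm_eq_one h hω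
      unfold logRemainder
      exact ((continuousAt_const.sub continuousAt_id).clog hre).add
        (Continuous.continuousAt (by fun_prop))
    refine hc.tendsto.comp ?_
    have : Tendsto (fun n => (r n : ℂ) * a ω) atTop (nhds (((1 : ℝ) : ℂ) * a ω)) :=
      ((Complex.continuous_ofReal.tendsto 1).comp hr).mul_const _
    simpa using this
  · refine lintegral_sq_norm_le_of_tendsto
      (f := fun k ω => -∑ m ∈ Finset.Ioc M (M + k), ((r n : ℂ) * a ω) ^ m / m)
      (fun k => by fun_prop) (Eventually.of_forall fun ω => ?_) fun k => ?_
    · refine tendsto_sum_Ioc_logRemainder M ?_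
      rw [norm_mul, Complex.norm_real, Real.norm_of_nonneg (hr0 n)]
      exact (mul_le_of_le_one_right (hr0 n) (ha1 ω)).trans_lt (hr1 n)
    · simp only [norm_neg]
      exact lintegral_sq_norm_sum_Ioc_le ha ha1 horth hM (by omega) (hr0 n) (hr1 n).le

theorem integrable_sq_norm_logRemainder (ha : Measurable a) (ha1 : ∀ ω, ‖a ω‖ ≤ 1)
    (hne : ∀ᵐ ω ∂μ, a ω ≠ 1)
    (horth : ∀ p q : ℕ, p ≠ q → ∫ ω, a ω ^ p * star (a ω ^ q) ∂μ = 0) {M : ℕ} (hM : 1 ≤ M) :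
    Integrable (fun ω => ‖logRemainder M (a ω)‖ ^ 2) μ := by
  refine ⟨(((measurable_logRemainder M).comp ha).norm.pow_const 2).aestronglyMeasurable, ?_⟩
  rw [hasFiniteIntegral_iff_ofReal (Eventually.of_forall fun ω => by positivity)]
  exact (lintegral_sq_norm_logRemainder_le ha ha1 hne horth hM).trans_lt ENNReal.ofReal_lt_top

theorem integral_sq_norm_logRemainder_le (ha : Measurable a) (ha1 : ∀ ω, ‖a ω‖ ≤ 1)
    (hne : ∀ᵐ ω ∂μ, a ω ≠ 1)
    (horth : ∀ p q : ℕ, p ≠ q → ∫ ω, a ω ^ p * star (a ω ^ q) ∂μ = 0) {M : ℕ} (hM : 1 ≤ M) :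
    ∫ ω, ‖logRemainder M (a ω)‖ ^ 2 ∂μ ≤ (∫ ω, ‖a ω‖ ^ 4 ∂μ) / M := by
  have h := lintegral_sq_norm_logRemainder_le ha ha1 hne horth hM
  rw [← ofReal_integral_eq_lintegral_ofReal (integrable_sq_norm_logRemainder ha ha1 hne horth hM)
    (Eventually.of_forall fun ω => by positivity)] at h
  exact (ENNReal.ofReal_le_ofReal_iff (div_nonneg (integral_nonneg fun ω => by positivity)
    (Nat.cast_nonneg M))).1 h

theorem integrable_logRemainder (ha : Measurable a) (ha1 : ∀ ω, ‖a ω‖ ≤ 1)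
    (hne : ∀ᵐ ω ∂μ, a ω ≠ 1)
    (horth : ∀ p q : ℕ, p ≠ q → ∫ ω, a ω ^ p * star (a ω ^ q) ∂μ = 0) {M : ℕ} (hM : 1 ≤ M) :
    Integrable (fun ω => logRemainder M (a ω)) μ := by
  refine ((integrable_const (1 : ℝ)).add
    (integrable_sq_norm_logRemainder ha ha1 hne horth hM)).mono'
    ((measurable_logRemainder M).comp ha).aestronglyMeasurable (Eventually.of_forall fun ω => ?_)
  simp only [Pi.add_apply]
  nlinarith [sq_nonneg (‖logRemainder M (a ω)‖ - 1)]

/-- Raising `M` adds powers of `a` with mean zero, so the integral does not depend on `M`; and the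
second moment of the remainder tends to zero as `M` grows. -/
theorem integral_logRemainder_eq_zero (ha : Measurable a) (ha1 : ∀ ω, ‖a ω‖ ≤ 1)
    (hne : ∀ᵐ ω ∂μ, a ω ≠ 1)
    (horth : ∀ p q : ℕ, p ≠ q → ∫ ω, a ω ^ p * star (a ω ^ q) ∂μ = 0) {M : ℕ} (hM : 1 ≤ M) :
    ∫ ω, logRemainder M (a ω) ∂μ = 0 := by
  have hstep : ∀ k, ∫ ω, logRemainder (M + k) (a ω) ∂μ = ∫ ω, logRemainder M (a ω) ∂μ := fun k => by
    induction k with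
    | zero => rfl
    | succ k ih =>
      have e : ∀ ω, logRemainder (M + (k + 1)) (a ω) =
          logRemainder (M + k) (a ω) + a ω ^ (M + k + 1) / (M + k + 1 : ℕ) := fun ω => by
        simp only [logRemainder, ← add_assoc, Finset.sum_range_succ _ (M + k + 1)]
      have h0 : ∫ ω, a ω ^ (M + k + 1) ∂μ = 0 := by
        simpa using horth (M + k + 1) 0 (by omega)
      simp only [e]
      rw [integral_add (integrable_logRemainder ha ha1 hne horth (by omega))
        ((integrable_pow_of_norm_le_one ha ha1 _).div_const _), integral_div, h0, zero_div,
        add_zero, ih]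
  have hQ1 : ∫ ω, ‖a ω‖ ^ 4 ∂μ ≤ 1 := by
    have := integral_mono (μ := μ) (integrable_norm_pow_of_norm_le_one ha ha1 4)
      (integrable_const (1 : ℝ)) fun ω => pow_le_one₀ (norm_nonneg _) (ha1 ω)
    simpa using this
  have hbound : ∀ ε : ℝ, 0 < ε → ‖∫ ω, logRemainder M (a ω) ∂μ‖ ≤ ε := fun ε hε => by
    obtain ⟨k, hk⟩ := exists_nat_gt (1 / ε ^ 2)
    have hMk : (0 : ℝ) < ((M + k : ℕ) : ℝ) := by exact_mod_cast (by omega : 0 < M + k)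
    have hV : ∫ ω, ‖logRemainder (M + k) (a ω)‖ ^ 2 ∂μ ≤ ε ^ 2 := by
      refine (integral_sq_norm_logRemainder_le ha ha1 hne horth (by omega)).trans ?_
      rw [div_le_iff₀ hMk]
      rw [div_lt_iff₀ (by positivity)] at hk
      push_cast
      nlinarith [(Nat.cast_nonneg M : (0 : ℝ) ≤ M), sq_nonneg ε]
    rw [← hstep k]
    calc ‖∫ ω, logRemainder (M + k) (a ω) ∂μ‖ ≤ ∫ ω, ‖logRemainder (M + k) (a ω)‖ ∂μ :=
          norm_integral_le_integral_norm _
      _ ≤ ∫ ω, (ε / 2 + ‖logRemainder (M + k) (a ω)‖ ^ 2 / (2 * ε)) ∂μ := by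
          refine integral_mono (integrable_logRemainder ha ha1 hne horth (by omega)).norm
            ((integrable_const _).add
              ((integrable_sq_norm_logRemainder ha ha1 hne horth (by omega)).div_const _))
            fun ω => ?_
          have e : ε / 2 + ‖logRemainder (M + k) (a ω)‖ ^ 2 / (2 * ε) -
              ‖logRemainder (M + k) (a ω)‖ = (‖logRemainder (M + k) (a ω)‖ - ε) ^ 2 / (2 * ε) := by
            field_simp
            ring
          have : 0 ≤ (‖logRemainder (M + k) (a ω)‖ - ε) ^ 2 / (2 * ε) := by positivity
          simp only
          linarith
      _ = ε / 2 + (∫ ω, ‖logRemainder (M + k) (a ω)‖ ^ 2 ∂μ) / (2 * ε) := by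
          rw [integral_add (integrable_const _)
            ((integrable_sq_norm_logRemainder ha ha1 hne horth (by omega)).div_const _),
            integral_div (2 * ε)]
          simp
      _ ≤ ε / 2 + ε ^ 2 / (2 * ε) := by gcongr
      _ = ε := by field_simp; ring
  exact norm_le_zero_iff.1 (le_of_forall_pos_le_add fun ε hε => by simpa using hbound ε hε)

/-! ### Expansion of the characteristic function of `log (1 - a)`. -/

theorem norm_exp_mul_I_sub_one_sub_le (x : ℝ) :
    ‖Complex.exp (x * Complex.I) - 1 - x * Complex.I‖ ≤ 3 * x ^ 2 := by
  have hn : ‖(x : ℂ) * Complex.I‖ = |x| := by simp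
  rcases le_total |x| 1 with h | h
  · refine (Complex.norm_exp_sub_one_sub_id_le (by rwa [hn])).trans ?_
    rw [hn, sq_abs]
    nlinarith [sq_nonneg x]
  · refine (norm_sub_le _ _).trans ((add_le_add_left (norm_sub_le _ _) _).trans ?_)
    rw [Complex.norm_exp_ofReal_mul_I, hn, norm_one, ← sq_abs]
    nlinarith

theorem norm_exp_mul_I_sub_taylor_two_le (x : ℝ) :
    ‖Complex.exp (x * Complex.I) - (1 + x * Complex.I - (x : ℂ) ^ 2 / 2)‖ ≤ 4 * |x| ^ 3 := by
  have hn : ‖(x : ℂ) * Complex.I‖ = |x| := by simp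
  rcases le_total |x| 1 with h | h
  · have := Complex.exp_bound (x := (x : ℂ) * Complex.I) (by rwa [hn]) (n := 3) (by norm_num)
    rw [hn] at this
    have e : ∑ m ∈ Finset.range 3, ((x : ℂ) * Complex.I) ^ m / (m.factorial : ℂ) =
        1 + x * Complex.I - (x : ℂ) ^ 2 / 2 := by
      simp [Finset.sum_range_succ, mul_pow]
      ring
    rw [e] at this
    refine this.trans ?_
    norm_num [Nat.factorial]
    nlinarith [pow_nonneg (abs_nonneg x) 3]
  · refine (norm_sub_le _ _).trans ((add_le_add_right ((norm_sub_le _ _).trans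
      (add_le_add_left (norm_add_le _ _) _)) _).trans ?_)
    rw [Complex.norm_exp_ofReal_mul_I, hn, norm_one, norm_div, norm_pow, Complex.norm_real,
      Real.norm_eq_abs, Complex.norm_ofNat]
    have h2 : 1 ≤ |x| ^ 2 := one_le_pow₀ h
    have h3 : |x| ^ 3 = |x| * |x| ^ 2 := by ring
    nlinarith

theorem norm_exp_add_sub_taylor_le (A B : ℝ) :
    ‖Complex.exp ((A + B : ℝ) * Complex.I) -
      (1 + A * Complex.I - (A : ℂ) ^ 2 / 2 + B * Complex.I)‖ ≤
      4 * |A| ^ 3 + 3 * B ^ 2 + |A| * |B| := by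
  have e : Complex.exp ((A + B : ℝ) * Complex.I) -
      (1 + A * Complex.I - (A : ℂ) ^ 2 / 2 + B * Complex.I) =
      (Complex.exp (A * Complex.I) - (1 + A * Complex.I - (A : ℂ) ^ 2 / 2)) +
      Complex.exp (A * Complex.I) * (Complex.exp (B * Complex.I) - 1 - B * Complex.I) +
      (Complex.exp (A * Complex.I) - 1) * (B * Complex.I) := by
    rw [Complex.ofReal_add, add_mul, Complex.exp_add]
    ring
  have h1 : ‖Complex.exp (A * Complex.I) - 1‖ ≤ |A| := by
    have := Real.norm_exp_I_mul_ofReal_sub_one_le (x := A)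
    rwa [mul_comm, Real.norm_eq_abs] at this
  rw [e]
  refine norm_add₃_le.trans (add_le_add (add_le_add (norm_exp_mul_I_sub_taylor_two_le A) ?_) ?_)
  · rw [norm_mul, Complex.norm_exp_ofReal_mul_I, one_mul]
    exact norm_exp_mul_I_sub_one_sub_le B
  · rw [norm_mul, norm_mul, Complex.norm_I, mul_one, Complex.norm_real, Real.norm_eq_abs]
    exact mul_le_mul_of_nonneg_right h1 (abs_nonneg _)

/-- Weighted AM-GM trades the cubic and mixed terms for `α²`, `α⁴` and `β²`, the moments that are
under control. The weight `w` will be `√k`. -/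
theorem taylor_error_le {A B α β s w : ℝ} (hα : 0 ≤ α) (hs : 0 ≤ s) (hw : 0 < w)
    (hA : |A| ≤ α * s) (hB : |B| ≤ β * s) :
    4 * |A| ^ 3 + 3 * B ^ 2 + |A| * |B| ≤
      5 / 2 * (s ^ 2 / w) * α ^ 2 + 2 * w * s ^ 4 * α ^ 4 + (3 * s ^ 2 + w * s ^ 2 / 2) * β ^ 2 := by
  have h1 : |A| ^ 3 ≤ (α * s) ^ 3 := pow_le_pow_left₀ (abs_nonneg _) hA 3
  have h2 : B ^ 2 ≤ (β * s) ^ 2 := by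
    rw [← sq_abs]; exact pow_le_pow_left₀ (abs_nonneg _) hB 2
  have h3 : |A| * |B| ≤ (α * s) * (β * s) :=
    mul_le_mul hA hB (abs_nonneg _) (mul_nonneg hα hs)
  have h4 : 2 * (α * s) ^ 3 ≤ s ^ 2 / w * α ^ 2 + w * s ^ 4 * α ^ 4 := by
    have : s ^ 2 / w * α ^ 2 + w * s ^ 4 * α ^ 4 - 2 * (α * s) ^ 3 =
        (α * s) ^ 2 / w * (1 - w * (α * s)) ^ 2 := by field_simp; ring
    have h : 0 ≤ (α * s) ^ 2 / w * (1 - w * (α * s)) ^ 2 := by positivity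
    linarith
  have h5 : 2 * ((α * s) * (β * s)) ≤ s ^ 2 / w * α ^ 2 + w * s ^ 2 * β ^ 2 := by
    have : s ^ 2 / w * α ^ 2 + w * s ^ 2 * β ^ 2 - 2 * ((α * s) * (β * s)) =
        s ^ 2 / w * (α - w * β) ^ 2 := by field_simp; ring
    have h : 0 ≤ s ^ 2 / w * (α - w * β) ^ 2 := by positivity
    linarith
  nlinarith

/-- The anisotropic part of the square is the real part of a multiple of `a²`, which has mean zero.
-/
theorem integral_inner_sq (ha : Measurable a) (ha1 : ∀ ω, ‖a ω‖ ≤ 1)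
    (horth : ∀ p q : ℕ, p ≠ q → ∫ ω, a ω ^ p * star (a ω ^ q) ∂μ = 0) (ξ : ℂ) :
    ∫ ω, (inner ℝ (a ω) ξ) ^ 2 ∂μ = ‖ξ‖ ^ 2 / 2 * ∫ ω, ‖a ω‖ ^ 2 ∂μ := by
  have e : ∀ ω, (inner ℝ (a ω) ξ) ^ 2 =
      ‖ξ‖ ^ 2 / 2 * ‖a ω‖ ^ 2 + (a ω ^ 2 * (star ξ ^ 2 / 2)).re := fun ω => by
    rw [Complex.inner, Complex.sq_norm, Complex.sq_norm]
    simp [Complex.normSq_apply, sq]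
    ring
  have h0 : ∫ ω, a ω ^ 2 * (star ξ ^ 2 / 2) ∂μ = 0 := by
    rw [integral_mul_const]
    simpa using Or.inl (horth 2 0 (by norm_num))
  have hi := (integrable_pow_of_norm_le_one (μ := μ) ha ha1 2).mul_const (star ξ ^ 2 / 2)
  have hre : ∫ ω, (a ω ^ 2 * (star ξ ^ 2 / 2)).re ∂μ = 0 := by
    have := integral_re hi
    rw [h0] at this
    simpa using this
  have hir : Integrable (fun ω => (a ω ^ 2 * (star ξ ^ 2 / 2)).re) μ := hi.re
  simp only [e]
  rw [integral_add ((integrable_norm_pow_of_norm_le_one ha ha1 2).const_mul _) hir,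
    integral_const_mul, hre, add_zero]

theorem norm_integral_exp_inner_log_sub_le (ha : Measurable a) (ha1 : ∀ ω, ‖a ω‖ ≤ 1)
    (hne : ∀ᵐ ω ∂μ, a ω ≠ 1)
    (horth : ∀ p q : ℕ, p ≠ q → ∫ ω, a ω ^ p * star (a ω ^ q) ∂μ = 0) {k : ℝ} (hk : 1 ≤ k)
    (h2 : ∫ ω, ‖a ω‖ ^ 2 ∂μ = 1 / k) (h4 : ∫ ω, ‖a ω‖ ^ 4 ∂μ ≤ 2 / k ^ 2) (ξ : ℂ) :
    ‖∫ ω, Complex.exp ((inner ℝ (Complex.log (1 - a ω)) ξ : ℝ) * Complex.I) ∂μ -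
      (1 - (‖ξ‖ ^ 2 / (4 * k) : ℝ))‖ ≤ (10 * ‖ξ‖ ^ 2 + 4 * ‖ξ‖ ^ 4) / (k * √k) := by
  have hR1 := integral_sq_norm_logRemainder_le ha ha1 hne horth le_rfl
  have hRint := integrable_logRemainder ha ha1 hne horth le_rfl
  have hRint2 := integrable_sq_norm_logRemainder ha ha1 hne horth le_rfl
  have hR0 := integral_logRemainder_eq_zero ha ha1 hne horth le_rfl
  have haint : Integrable a μ := by simpa using integrable_pow_of_norm_le_one (μ := μ) ha ha1 1
  have ha0 : ∫ ω, a ω ∂μ = 0 := by simpa using horth 1 0 one_ne_zero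
  have hRmeas := (measurable_logRemainder 1).comp ha
  rw [Nat.cast_one, div_one] at hR1
  set R : Ω → ℂ := fun ω => logRemainder 1 (a ω) with hR
  let A : Ω → ℝ := fun ω => -inner ℝ (a ω) ξ
  let B : Ω → ℝ := fun ω => inner ℝ (R ω) ξ
  have hAB : ∀ ω, inner ℝ (Complex.log (1 - a ω)) ξ = A ω + B ω := fun ω => by
    simp only [A, B, R, logRemainder]
    rw [← inner_neg_left, ← inner_add_left]
    -- The term `m = 0` of the Taylor sum is `1 / 0 = 0`, so only `a ω` remains.
    simp [Finset.sum_range_succ]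
  have hA : Integrable A μ := (haint.inner_const ξ).neg
  have hB : Integrable B μ := hRint.inner_const ξ
  have hA0 : ∫ ω, A ω ∂μ = 0 := by
    simp only [A]
    rw [integral_neg]
    have h := integral_inner (𝕜 := ℝ) haint ξ
    rw [ha0, inner_zero_right] at h
    simpa only [real_inner_comm ξ, neg_eq_zero] using h
  have hB0 : ∫ ω, B ω ∂μ = 0 := by
    have h := integral_inner (𝕜 := ℝ) hRint ξ
    rw [hR0, inner_zero_right] at h
    simpa only [B, real_inner_comm ξ] using h
  have hA2 : ∫ ω, A ω ^ 2 ∂μ = ‖ξ‖ ^ 2 / (2 * k) := by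
    simp only [A, neg_sq]
    rw [integral_inner_sq ha ha1 horth, h2]
    field_simp
  have hAle : ∀ ω, |A ω| ≤ ‖a ω‖ * ‖ξ‖ := fun ω => by
    simp only [A, abs_neg]
    exact abs_real_inner_le_norm _ _
  have hA2int : Integrable (fun ω => A ω ^ 2) μ := by
    refine ((integrable_norm_pow_of_norm_le_one (μ := μ) ha ha1 2).const_mul (‖ξ‖ ^ 2)).mono'
      (hA.aestronglyMeasurable.pow 2) (Eventually.of_forall fun ω => ?_)
    rw [norm_pow, Real.norm_eq_abs, mul_comm, ← mul_pow]
    exact pow_le_pow_left₀ (abs_nonneg _) (hAle ω) 2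
  have hT : ∫ ω, (1 + (A ω : ℂ) * Complex.I - (A ω : ℂ) ^ 2 / 2 + (B ω : ℂ) * Complex.I) ∂μ =
      1 - ((‖ξ‖ ^ 2 / (4 * k) : ℝ) : ℂ) := by
    have i1 : Integrable (fun ω => (A ω : ℂ) * Complex.I) μ := hA.ofReal.mul_const _
    have i2 : Integrable (fun ω => (A ω : ℂ) ^ 2 / 2) μ := by
      simpa using (hA2int.ofReal (𝕜 := ℂ)).div_const 2
    have i3 : Integrable (fun ω => (B ω : ℂ) * Complex.I) μ := hB.ofReal.mul_const _
    have i4 : Integrable (fun ω => 1 + (A ω : ℂ) * Complex.I) μ := (integrable_const _).add i1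
    have i5 : Integrable (fun ω => 1 + (A ω : ℂ) * Complex.I - (A ω : ℂ) ^ 2 / 2) μ := i4.sub i2
    rw [integral_add i5 i3, integral_sub i4 i2, integral_add (integrable_const _) i1,
      integral_mul_const, integral_mul_const, integral_div, integral_complex_ofReal,
      integral_complex_ofReal, hA0, hB0]
    have : ∫ ω, (A ω : ℂ) ^ 2 ∂μ = ((‖ξ‖ ^ 2 / (2 * k) : ℝ) : ℂ) := by
      rw [← hA2, ← integral_complex_ofReal]
      simp
    rw [this]
    simp
    ring
  have hTint : Integrable (fun ω =>
      (1 : ℂ) + (A ω : ℂ) * Complex.I - (A ω : ℂ) ^ 2 / 2 + (B ω : ℂ) * Complex.I) μ := by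
    refine (((integrable_const _).add (hA.ofReal.mul_const Complex.I)).sub ?_).add (hB.ofReal.mul_const _)
    simpa using (hA2int.ofReal (𝕜 := ℂ)).div_const 2
  have hAm : Measurable A := (ha.inner_const (c := ξ)).neg
  have hBm : Measurable B := hRmeas.inner_const
  have hexpint : Integrable (fun ω => Complex.exp ((A ω + B ω : ℝ) * Complex.I)) μ :=
    Integrable.of_bound (C := 1) (Measurable.aestronglyMeasurable (by fun_prop))
      (Eventually.of_forall fun ω => (Complex.norm_exp_ofReal_mul_I _).le)
  have hw : 0 < √k := Real.sqrt_pos.2 (by linarith)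
  have hw1 : 1 ≤ √k := Real.one_le_sqrt.2 hk
  have hwk : k = √k ^ 2 := (Real.sq_sqrt (by linarith)).symm
  -- With this weight, and second and fourth moments of order `1/k` and `1/k²`, every error term is
  -- `O(k^(-3/2))`.
  set w := √k
  set s := ‖ξ‖ with hs
  have hs0 : 0 ≤ s := norm_nonneg _
  simp only [hAB]
  rw [← hT, ← integral_sub hexpint hTint]
  have j1 := (integrable_norm_pow_of_norm_le_one (μ := μ) ha ha1 2).const_mul (5 / 2 * (s ^ 2 / w))
  have j2 := (integrable_norm_pow_of_norm_le_one (μ := μ) ha ha1 4).const_mul (2 * w * s ^ 4)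
  have j3 := hRint2.const_mul (3 * s ^ 2 + w * s ^ 2 / 2)
  have j12 : Integrable (fun ω => 5 / 2 * (s ^ 2 / w) * ‖a ω‖ ^ 2 + 2 * w * s ^ 4 * ‖a ω‖ ^ 4) μ :=
    j1.add j2
  calc _ ≤ ∫ ω, (5 / 2 * (s ^ 2 / w) * ‖a ω‖ ^ 2 + 2 * w * s ^ 4 * ‖a ω‖ ^ 4 +
        (3 * s ^ 2 + w * s ^ 2 / 2) * ‖R ω‖ ^ 2) ∂μ := by
        refine norm_integral_le_of_norm_le (j12.add j3) (Eventually.of_forall fun ω => ?_)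
        exact (norm_exp_add_sub_taylor_le (A ω) (B ω)).trans (taylor_error_le (norm_nonneg _) hs0 hw (hAle ω) (abs_real_inner_le_norm _ _))
    _ = 5 / 2 * (s ^ 2 / w) * (1 / k) + 2 * w * s ^ 4 * ∫ ω, ‖a ω‖ ^ 4 ∂μ +
        (3 * s ^ 2 + w * s ^ 2 / 2) * ∫ ω, ‖R ω‖ ^ 2 ∂μ := by
        rw [integral_add j12 j3, integral_add j1 j2, integral_const_mul, integral_const_mul,
          integral_const_mul, h2]
    _ ≤ 5 / 2 * (s ^ 2 / w) * (1 / k) + 2 * w * s ^ 4 * (2 / k ^ 2) +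
        (3 * s ^ 2 + w * s ^ 2 / 2) * (2 / k ^ 2) := by
        gcongr
        exact hR1.trans h4
    _ ≤ (10 * s ^ 2 + 4 * s ^ 4) / (k * w) := by
        rw [hwk]
        have e : (10 * s ^ 2 + 4 * s ^ 4) / (w ^ 2 * w) - (5 / 2 * (s ^ 2 / w) * (1 / w ^ 2) +
            2 * w * s ^ 4 * (2 / (w ^ 2) ^ 2) + (3 * s ^ 2 + w * s ^ 2 / 2) * (2 / (w ^ 2) ^ 2)) =
            s ^ 2 * (6 * (w - 1) + w / 2) / w ^ 4 := by
          field_simp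
          ring
        have : 0 ≤ s ^ 2 * (6 * (w - 1) + w / 2) / w ^ 4 := by
          have : 0 ≤ w - 1 := by linarith
          positivity
        linarith

end RotationInvariant

/-! ### The product of characteristic functions and its limit. -/

theorem norm_integral_exp_entry_sub_le (k : ℕ) (ξ : ℂ) :
    ‖∫ V : Matrix.unitaryGroup (Fin (k + 1)) ℂ,
        Complex.exp ((inner ℝ (Complex.log (1 - V.1 0 0)) ξ : ℝ) * Complex.I) ∂unitaryHaar (k + 1) -
      (1 - (‖ξ‖ ^ 2 / (4 * ((k + 1 : ℕ) : ℝ)) : ℝ))‖ ≤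
      (10 * ‖ξ‖ ^ 2 + 4 * ‖ξ‖ ^ 4) / (((k + 1 : ℕ) : ℝ) * √((k + 1 : ℕ) : ℝ)) := by
  have hk : (1 : ℝ) ≤ ((k + 1 : ℕ) : ℝ) := by exact_mod_cast Nat.le_add_left 1 k
  refine norm_integral_exp_inner_log_sub_le (measurable_unitaryGroup_entry 0 0)
    (fun V => norm_unitaryGroup_entry_le V 0 0) (ae_entry_ne_one 0 0)
    (fun p q hpq => integral_entry_pow_mul_conj_pow 0 0 hpq) hk ?_ ?_ ξ
  · simp only [Complex.sq_norm]
    exact integral_normSq_entry 0 0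
  · have e : ∀ z : ℂ, ‖z‖ ^ 4 = Complex.normSq z ^ 2 := fun z => by
      rw [← Complex.sq_norm, ← pow_mul]
    simp only [e]
    rw [integral_normSq_entry_sq, sq]
    gcongr
    linarith

theorem norm_exp_neg_sub_one_sub_le {x : ℝ} (hx : 0 ≤ x) : |Real.exp (-x) - (1 - x)| ≤ x ^ 2 := by
  have h1 := Real.one_sub_le_exp_neg x
  have h2 := Real.add_one_le_exp x
  have h3 : Real.exp (-x) * Real.exp x = 1 := by rw [← Real.exp_add]; simp
  have h4 : 0 < Real.exp (-x) := Real.exp_pos _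
  have h5 : Real.exp (-x) * (1 + x) ≤ 1 := by nlinarith
  rw [abs_of_nonneg (by linarith)]
  have h6 : Real.exp (-x) ≤ 1 := Real.exp_le_one_iff.2 (by linarith)
  nlinarith

theorem norm_prod_sub_prod_le {ι : Type*} (s : Finset ι) {z w : ι → ℂ} (hz : ∀ i ∈ s, ‖z i‖ ≤ 1)
    (hw : ∀ i ∈ s, ‖w i‖ ≤ 1) : ‖∏ i ∈ s, z i - ∏ i ∈ s, w i‖ ≤ ∑ i ∈ s, ‖z i - w i‖ := by
  classical
  induction s using Finset.induction_on with
  | empty => simp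
  | insert i s hi ih =>
    rw [Finset.prod_insert hi, Finset.prod_insert hi, Finset.sum_insert hi]
    have hs := ih (fun j hj => hz j (Finset.mem_insert_of_mem hj))
      fun j hj => hw j (Finset.mem_insert_of_mem hj)
    have hp : ‖∏ j ∈ s, z j‖ ≤ 1 := by
      rw [norm_prod]
      exact Finset.prod_le_one (fun _ _ => norm_nonneg _)
        fun j hj => hz j (Finset.mem_insert_of_mem hj)
    have e : z i * ∏ j ∈ s, z j - w i * ∏ j ∈ s, w j =
        (z i - w i) * ∏ j ∈ s, z j + w i * (∏ j ∈ s, z j - ∏ j ∈ s, w j) := by ring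
    rw [e]
    refine (norm_add_le _ _).trans (add_le_add ?_ ?_)
    · rw [norm_mul]
      exact mul_le_of_le_one_right (norm_nonneg _) hp
    · rw [norm_mul]
      exact (mul_le_of_le_one_left (norm_nonneg _) (hw i (Finset.mem_insert_self i s))).trans hs

theorem summable_one_div_mul_sqrt :
    Summable fun k : ℕ => 1 / (((k + 1 : ℕ) : ℝ) * √((k + 1 : ℕ) : ℝ)) := by
  have h := (summable_nat_add_iff 1).2 (Real.summable_one_div_nat_rpow (p := 3 / 2).2 (by norm_num))
  refine h.congr fun k => ?_
  have hk : (0 : ℝ) < ((k + 1 : ℕ) : ℝ) := by positivity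
  rw [Real.sqrt_eq_rpow, show (3 / 2 : ℝ) = 1 + 1 / 2 by norm_num, Real.rpow_add hk, Real.rpow_one]

/-- All factors have modulus at most one, so the errors add. Passing from `1 - x` to `exp (-x)`
costs `x²`, which raises the coefficient of `‖ξ‖ ^ 4` from `4` to `5`. The bound is independent of
`n`, hence small once `ξ` is small. -/
theorem norm_integral_exp_logDetRec_sub_le (n : ℕ) (ξ : ℂ) :
    ‖∫ V, Complex.exp ((inner ℝ (logDetRec n V) ξ : ℝ) * Complex.I) ∂unitaryHaar n -
      (Real.exp (-(‖ξ‖ ^ 2 / 4 * (harmonic n : ℝ))) : ℝ)‖ ≤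
      (10 * ‖ξ‖ ^ 2 + 5 * ‖ξ‖ ^ 4) *
        ∑' k : ℕ, 1 / (((k + 1 : ℕ) : ℝ) * √((k + 1 : ℕ) : ℝ)) := by
  have hprod : ((Real.exp (-(‖ξ‖ ^ 2 / 4 * (harmonic n : ℝ))) : ℝ) : ℂ) =
      ∏ k ∈ Finset.range n, ((Real.exp (-(‖ξ‖ ^ 2 / (4 * ((k + 1 : ℕ) : ℝ)))) : ℝ) : ℂ) := by
    rw [← Complex.ofReal_prod, ← Real.exp_sum]
    congr 2
    rw [harmonic, Rat.cast_sum, Finset.mul_sum, ← Finset.sum_neg_distrib]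
    refine Finset.sum_congr rfl fun k _ => ?_
    push_cast
    field_simp
  rw [integral_exp_logDetRec, hprod]
  refine (norm_prod_sub_prod_le _ (fun k _ => ?_) fun k _ => ?_).trans ?_
  · refine (norm_integral_le_integral_norm _).trans ?_
    simp only [Complex.norm_exp_ofReal_mul_I, integral_const, probReal_univ, one_smul, le_refl]
  · rw [Complex.norm_real, Real.norm_of_nonneg (Real.exp_pos _).le, Real.exp_le_one_iff]
    have : 0 ≤ ‖ξ‖ ^ 2 / (4 * ((k + 1 : ℕ) : ℝ)) := by positivity
    linarith
  · calc _ ≤ ∑ k ∈ Finset.range n, (10 * ‖ξ‖ ^ 2 + 5 * ‖ξ‖ ^ 4) *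
          (1 / (((k + 1 : ℕ) : ℝ) * √((k + 1 : ℕ) : ℝ))) := by
          refine Finset.sum_le_sum fun k _ => ?_
          refine (norm_sub_le_norm_sub_add_norm_sub _
            (1 - ((‖ξ‖ ^ 2 / (4 * ((k + 1 : ℕ) : ℝ)) : ℝ) : ℂ)) _).trans ?_
          have h1 := norm_integral_exp_entry_sub_le k ξ
          have h2 := norm_exp_neg_sub_one_sub_le
            (by positivity : 0 ≤ ‖ξ‖ ^ 2 / (4 * ((k + 1 : ℕ) : ℝ)))
          have h3 : ‖(1 - ((‖ξ‖ ^ 2 / (4 * ((k + 1 : ℕ) : ℝ)) : ℝ) : ℂ)) -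
              ((Real.exp (-(‖ξ‖ ^ 2 / (4 * ((k + 1 : ℕ) : ℝ)))) : ℝ) : ℂ)‖ =
              |Real.exp (-(‖ξ‖ ^ 2 / (4 * ((k + 1 : ℕ) : ℝ)))) -
                (1 - ‖ξ‖ ^ 2 / (4 * ((k + 1 : ℕ) : ℝ)))| := by
            rw [norm_sub_rev, ← Real.norm_eq_abs, ← Complex.norm_real]
            push_cast
            rfl
          rw [h3]
          have hk : (1 : ℝ) ≤ ((k + 1 : ℕ) : ℝ) := by exact_mod_cast Nat.le_add_left 1 k
          have hsq := Real.sq_sqrt (zero_le_one.trans hk)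
          have hw1 : 1 ≤ √((k + 1 : ℕ) : ℝ) := Real.one_le_sqrt.2 hk
          have hwle : √((k + 1 : ℕ) : ℝ) ≤ ((k + 1 : ℕ) : ℝ) := by nlinarith
          have h4 : (‖ξ‖ ^ 2 / (4 * ((k + 1 : ℕ) : ℝ))) ^ 2 ≤
              ‖ξ‖ ^ 4 / (((k + 1 : ℕ) : ℝ) * √((k + 1 : ℕ) : ℝ)) := by
            rw [div_pow, ← pow_mul]
            gcongr
            nlinarith
          have h5 : (10 * ‖ξ‖ ^ 2 + 5 * ‖ξ‖ ^ 4) * (1 / (((k + 1 : ℕ) : ℝ) * √((k + 1 : ℕ) : ℝ))) =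
              (10 * ‖ξ‖ ^ 2 + 4 * ‖ξ‖ ^ 4) / (((k + 1 : ℕ) : ℝ) * √((k + 1 : ℕ) : ℝ)) +
                ‖ξ‖ ^ 4 / (((k + 1 : ℕ) : ℝ) * √((k + 1 : ℕ) : ℝ)) := by ring
          rw [h5]
          exact add_le_add h1 (h2.trans h4)
      _ = (10 * ‖ξ‖ ^ 2 + 5 * ‖ξ‖ ^ 4) * ∑ k ∈ Finset.range n,
          (1 / (((k + 1 : ℕ) : ℝ) * √((k + 1 : ℕ) : ℝ))) := by rw [Finset.mul_sum]
      _ ≤ _ := by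
          refine mul_le_mul_of_nonneg_left ?_ (by positivity)
          exact summable_one_div_mul_sqrt.sum_le_tsum _ fun k _ => by positivity

open scoped Topology in
theorem tendsto_harmonic_div_log : Tendsto (fun n : ℕ => (harmonic n : ℝ) / Real.log n) atTop (𝓝 1) := by
  have hlog : Tendsto (fun n : ℕ => Real.log n) atTop atTop :=
    Real.tendsto_log_atTop.comp tendsto_natCast_atTop_atTop
  have hup : Tendsto (fun n : ℕ => (Real.log n)⁻¹ + 1) atTop (𝓝 1) := by
    simpa using (tendsto_inv_atTop_zero.comp hlog).add_const 1
  refine tendsto_of_tendsto_of_tendsto_of_le_of_le' tendsto_const_nhds hup ?_ ?_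
  · filter_upwards [hlog.eventually_gt_atTop 0, eventually_gt_atTop 0] with n hn hn0
    rw [le_div_iff₀ hn, one_mul]
    refine le_trans (Real.log_le_log (by exact_mod_cast hn0) ?_) (log_add_one_le_harmonic n)
    push_cast
    linarith
  · filter_upwards [hlog.eventually_gt_atTop 0] with n hn
    rw [div_le_iff₀ hn, add_mul, one_mul, inv_mul_cancel₀ hn.ne']
    exact harmonic_le_one_add_log n

open scoped Topology in
theorem tendsto_integral_exp_logDetRec (t : ℂ) :
    Tendsto (fun n : ℕ => ∫ V, Complex.exp ((inner ℝ (logDetRec n V)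
        ((√(1 / 2 * Real.log n))⁻¹ • t) : ℝ) * Complex.I) ∂unitaryHaar n) atTop
      (𝓝 ((Real.exp (-(‖t‖ ^ 2 / 2)) : ℝ) : ℂ)) := by
  have hlog : Tendsto (fun n : ℕ => Real.log n) atTop atTop :=
    Real.tendsto_log_atTop.comp tendsto_natCast_atTop_atTop
  -- This holds only eventually: for `n ≤ 1` the logarithm is `0`.
  have hnorm : ∀ᶠ n : ℕ in atTop, ‖(√(1 / 2 * Real.log n))⁻¹ • t‖ ^ 2 =
      2 * ‖t‖ ^ 2 * (Real.log n)⁻¹ := by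
    filter_upwards [hlog.eventually_gt_atTop 0] with n hn
    rw [norm_smul, mul_pow, norm_inv, inv_pow, Real.norm_eq_abs, sq_abs,
      Real.sq_sqrt (by positivity)]
    field_simp
  have hxi2 : Tendsto (fun n : ℕ => ‖(√(1 / 2 * Real.log n))⁻¹ • t‖ ^ 2) atTop (𝓝 0) := by
    have := (tendsto_inv_atTop_zero.comp hlog).const_mul (2 * ‖t‖ ^ 2)
    rw [mul_zero] at this
    exact this.congr' (hnorm.mono fun n hn => hn.symm)
  have hmain : Tendsto (fun n : ℕ => ((Real.exp (-(‖(√(1 / 2 * Real.log n))⁻¹ • t‖ ^ 2 / 4 *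
      (harmonic n : ℝ))) : ℝ) : ℂ)) atTop (𝓝 ((Real.exp (-(‖t‖ ^ 2 / 2)) : ℝ) : ℂ)) := by
    refine (Complex.continuous_ofReal.tendsto _).comp ((Real.continuous_exp.tendsto _).comp
      (Tendsto.neg ?_))
    have := tendsto_harmonic_div_log.const_mul (‖t‖ ^ 2 / 2)
    rw [mul_one] at this
    refine this.congr' ?_
    filter_upwards [hnorm] with n hn
    rw [hn]
    ring
  refine hmain.congr_dist ?_
  have hbound := ((hxi2.const_mul 10).add ((hxi2.pow 2).const_mul 5)).mul_const
    (∑' k : ℕ, 1 / (((k + 1 : ℕ) : ℝ) * √((k + 1 : ℕ) : ℝ)))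
  simp only [mul_zero, ne_eq, OfNat.ofNat_ne_zero, not_false_eq_true, zero_pow, add_zero,
    zero_mul] at hbound
  refine squeeze_zero (fun n => dist_nonneg) (fun n => ?_) hbound
  rw [dist_comm, dist_eq_norm]
  refine (norm_integral_exp_logDetRec_sub_le n _).trans_eq ?_
  rw [← pow_mul]

theorem charFun_map_add_I_mul {Ω' : Type*} [MeasurableSpace Ω'] {P' : Measure Ω'}
    [IsProbabilityMeasure P'] {N₁ N₂ : Ω' → ℝ}
    (hN₁ : HasLaw N₁ (gaussianReal 0 1) P') (hN₂ : HasLaw N₂ (gaussianReal 0 1) P')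
    (hind : IndepFun N₁ N₂ P') (t : ℂ) :
    charFun (P'.map fun ω => (N₁ ω : ℂ) + Complex.I * (N₂ ω : ℂ)) t =
      ((Real.exp (-(‖t‖ ^ 2 / 2)) : ℝ) : ℂ) := by
  have hm₁ := hN₁.aemeasurable
  have hm₂ := hN₂.aemeasurable
  have hone : ∀ {X : Ω' → ℝ}, HasLaw X (gaussianReal 0 1) P' → ∀ s : ℝ,
      ∫ ω, Complex.exp (s * X ω * Complex.I) ∂P' = Complex.exp (-(s : ℂ) ^ 2 / 2) := by
    intro X hX s
    have h := charFun_gaussianReal (μ := 0) (v := 1) s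
    rw [← hX.map_eq, charFun_apply_real, integral_map hX.aemeasurable
      (Measurable.aestronglyMeasurable (by fun_prop))] at h
    rw [h]
    simp
    ring_nf
  rw [charFun_apply, integral_map (by fun_prop) (Measurable.aestronglyMeasurable (by fun_prop))]
  have e : ∀ ω, Complex.exp ((inner ℝ ((N₁ ω : ℂ) + Complex.I * (N₂ ω : ℂ)) t : ℝ) * Complex.I) =
      Complex.exp (t.re * N₁ ω * Complex.I) * Complex.exp (t.im * N₂ ω * Complex.I) := fun ω => by
    rw [← Complex.exp_add, Complex.inner]
    congr 1
    simp
    ring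
  simp only [e]
  have hind' : IndepFun (fun ω => Complex.exp (t.re * N₁ ω * Complex.I))
      (fun ω => Complex.exp (t.im * N₂ ω * Complex.I)) P' :=
    hind.comp (φ := fun x : ℝ => Complex.exp (t.re * x * Complex.I))
      (ψ := fun x : ℝ => Complex.exp (t.im * x * Complex.I)) (by fun_prop) (by fun_prop)
  rw [hind'.integral_fun_mul_eq_mul_integral
    (AEMeasurable.aestronglyMeasurable (by fun_prop))
    (AEMeasurable.aestronglyMeasurable (by fun_prop)), hone hN₁, hone hN₂, ← Complex.exp_add,
    Complex.ofReal_exp, Complex.sq_norm, Complex.normSq_apply]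
  congr 1
  push_cast
  ring

theorem theorem4p1
    -- for every `N`, a random matrix `V N` following the Haar measure on `U(N)`
    {Ω : ℕ → Type*} [∀ N, MeasurableSpace (Ω N)]
    (P : ∀ N, Measure (Ω N)) [∀ N, IsProbabilityMeasure (P N)]
    (V : ∀ N, Ω N → Matrix.unitaryGroup (Fin N) ℂ)
    (hV : ∀ N, HasLaw (V N) (unitaryHaar N) (P N))
    -- two independent standard Gaussian variables
    {Ω' : Type*} [MeasurableSpace Ω'] (P' : Measure Ω') [IsProbabilityMeasure P']
    (N₁ N₂ : Ω' → ℝ)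
    (hN₁ : HasLaw N₁ (gaussianReal 0 1) P') (hN₂ : HasLaw N₂ (gaussianReal 0 1) P')
    (hind : IndepFun N₁ N₂ P') :
    TendstoInDistribution
      (fun N ω => logDetOneSub (V N ω : Matrix (Fin N) (Fin N) ℂ) /
        ((Real.sqrt (1 / 2 * Real.log N) : ℝ) : ℂ))
      atTop
      (fun ω => (N₁ ω : ℂ) + Complex.I * (N₂ ω : ℂ)) P P' := by
  have hae : ∀ N, (fun ω => logDetOneSub (V N ω : Matrix (Fin N) (Fin N) ℂ)) =ᵐ[P N]
      fun ω => logDetRec N (V N ω) := fun N => by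
    have h := (hV N).map_eq ▸ ae_logDetOneSub_eq N
    filter_upwards [ae_of_ae_map (hV N).aemeasurable h] with ω hω using hω.2
  have haem : ∀ N, AEMeasurable (fun ω => logDetOneSub (V N ω : Matrix (Fin N) (Fin N) ℂ)) (P N) :=
    fun N => ((measurable_logDetRec N).comp_aemeasurable (hV N).aemeasurable).congr (hae N).symm
  have hX : ∀ N, AEMeasurable (fun ω => logDetOneSub (V N ω : Matrix (Fin N) (Fin N) ℂ) /
      ((Real.sqrt (1 / 2 * Real.log N) : ℝ) : ℂ)) (P N) := fun N => (haem N).div_const _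
  have hm₁ := hN₁.aemeasurable
  have hm₂ := hN₂.aemeasurable
  refine ⟨hX, by fun_prop, ?_⟩
  -- Lévy's continuity theorem on `ℂ` as a real inner product space. The normalisation is a real
  -- scalar, so it moves from the variable to `t`.
  refine ProbabilityMeasure.tendsto_of_tendsto_charFun fun t => ?_
  simp only [ProbabilityMeasure.coe_mk]
  rw [charFun_map_add_I_mul hN₁ hN₂ hind t]
  refine (tendsto_integral_exp_logDetRec t).congr fun N => ?_
  rw [charFun_apply, integral_map (hX N) (Measurable.aestronglyMeasurable (by fun_prop)),
    ← (hV N).map_eq, integral_map (hV N).aemeasurable (Measurable.aestronglyMeasurable (by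
      have := measurable_logDetRec N
      fun_prop))]
  refine integral_congr_ae ?_
  filter_upwards [hae N] with ω hω
  have e : logDetRec N (V N ω) / ((√(1 / 2 * Real.log N) : ℝ) : ℂ) =
      (√(1 / 2 * Real.log N))⁻¹ • logDetRec N (V N ω) := by
    rw [Complex.real_smul, Complex.ofReal_inv, div_eq_inv_mul]
  rw [hω, e, real_inner_smul_left, real_inner_smul_right]
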